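/- **Setting.** Let $\mathcal X,\mathcal Y$ be finite alphabets, $Q(y|x)$ the transition matrix of a discrete memoryless channel, $\star\in\mathcal X$ a designated "no-input" symbol, and $Q_\star=Q(\cdot|\star)$. Logarithms are natural. For an input distribution $P$ let $(PQ)_{\mathcal Y}(y)=\sum_x P(x)Q(y|x)$, $I(PQ)=\sum_{x,y}P(x)Q(y|x)\ln\frac{Q(y|x)}{(PQ)_{\mathcal Y}(y)}$, and $C=\max_P I(PQ)$; assume $C>0$. For distributions $V,W$ on $\mathcal Y$ let $D(V\|W)=\sum_y V(y)\ln\frac{V(y)}{W(y)}\in[0,\infty]$. A code of blocklength $n\ge1$ consists of $M\ge2$ messages, codewords $c^n(m)\in\mathcal X^n$, $1\le m\le M$, and, for each integer asynchronism level $A\ge1$ (known to the receiver), a sequential decoder $(\tau,\phi)$: a (possibly randomized) stopping time $1\le\tau\le A+n-1$ with respect to the outputs $Y_1,Y_2,\dots,Y_{A+n-1}$, and a decision $\phi(Y_1,\dots,Y_\tau)\in\{1,\dots,M\}$. Under $\mathbb P_{m,t}$ (message $m$ starts being sent at time $t$) the outputs are independent, $Y_s\sim Q(\cdot|c_{s-t+1}(m))$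 for $t\le s\le t+n-1$ and $Y_s\sim Q_\star$ otherwise. The error probability at level $A$ is $\max_m\frac1A\sum_{t=1}^A\mathbb P_{m,t}(\phi\ne m)$, and the rate at level $A$ is $\ln M/\Delta$ with $\Delta=\max_m\frac1A\sum_{t=1}^A\mathbb E_{m,t}\big[(\tau-t)^+\big]$ (infinite if $\Delta=0$). A pair $(R,\alpha)$ with $R,\alpha\ge0$ is *achievable* if there is a sequence of codes, indexed by the blocklength $n\ge1$, such that for every $\varepsilon>0$ and all sufficiently large $n$ the $n$-th code, at asynchronism level $A_n=\lceil e^{(\alpha-\varepsilon)n}\rceil$, has rate at least $R-\varepsilon$ and error probability at most $\varepsilon$. Let $\alpha(R)\in[0,\infty]$ be the supremum of the exponents $\alpha$ achievable at rate $R$. **Theorem (Lower bound on asynchronous capacity).** Let $\alpha\ge0$ and let $P$ be an input distribution such that every distribution $V$ on $\mathcal Y$ satisfies $D(V\|(PQ)_{\mathcal Y})\ge\alpha$ or $D(V\|Q_\star)\ge\alpha$, i.e., $\min_V\max\{D(V\|(PQ)_{\mathcal Y}),D(V\|Q_\star)\}\ge\alpha$. Then the rate–exponent pair $(I(PQ),\alpha)$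 is achievable. Consequently, for every $R\in(0,C]$, $$\alpha(R)\ \ge\ \alpha_-(R)\ :=\ \max_{P:\,I(PQ)\ge R}\ \min_{V}\ \max\{D(V\|(PQ)_{\mathcal Y}),D(V\|Q_\star)\},$$ where the minimum over $V$ (for every input distribution $P$) and the maximum over $P$ are attained, with values in $[0,\infty]$. -/

import Mathlib

noncomputable section

open scoped BigOperators

namespace AsyncComm

/-! Distributions on a finite alphabet are points of `stdSimplex ℝ _`; a channel with input alphabet
`X` and output alphabet `Y` is a matrix `Q : X → Y → ℝ`, `Q x y = Q(y|x)`, each row of which is a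
distribution on `Y`. Logarithms are natural. -/

section Information

variable {X Y : Type*} [Fintype X] [Fintype Y]

/-- The output distribution `(PQ)_Y` of the channel `Q` under the input distribution `P`. -/
def outputDist (P : X → ℝ) (Q : X → Y → ℝ) (y : Y) : ℝ :=
  ∑ x, P x * Q x y

/-- The mutual information `I(PQ) = ∑ x, P(x) ∑ y, Q(y|x) ln (Q(y|x) / (PQ)_Y(y))`. If the
denominator vanishes, then so does `P(x) Q(y|x)`, so every undefined term counts as `0`. -/
def mutualInfo (P : X → ℝ) (Q : X → Y → ℝ) : ℝ :=
  ∑ x, P x * ∑ y, Q x y * Real.log (Q x y / outputDist P Q y)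

/-- The capacity `C = max_P I(PQ)` of the synchronous channel. -/
def syncCapacity (Q : X → Y → ℝ) : ℝ :=
  sSup ((fun P => mutualInfo P Q) '' stdSimplex ℝ X)

open Classical in
/-- The information divergence `D(V‖W) = ∑ y, V(y) ln (V(y) / W(y))`, with `0 ln (0/0) = 0` and the
value `+∞` when `V(y) > 0 = W(y)` for some `y`. -/
def divergence (V W : Y → ℝ) : EReal :=
  if ∀ y, W y = 0 → V y = 0 then ((∑ y, V y * Real.log (V y / W y) : ℝ) : EReal) else ⊤

/-- `max {D(V‖(PQ)_Y), D(V‖Q_⋆)}`. -/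
def maxDivergence (Q : X → Y → ℝ) (star : X) (P : X → ℝ) (V : Y → ℝ) : EReal :=
  max (divergence V (outputDist P Q)) (divergence V (Q star))

/-- `min_V max {D(V‖(PQ)_Y), D(V‖Q_⋆)}` over all distributions `V` on the output alphabet. -/
def noiseExponent (Q : X → Y → ℝ) (star : X) (P : X → ℝ) : EReal :=
  ⨅ V ∈ stdSimplex ℝ Y, maxDivergence Q star P V

/-- `α₋(R)`: the maximum of `min_V max {D(V‖(PQ)_Y), D(V‖Q_⋆)}` over all input distributions `P`
with `I(PQ) ≥ R`. -/
def alphaMinus (Q : X → Y → ℝ) (star : X) (R : ℝ) : EReal :=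
  ⨆ P ∈ {P ∈ stdSimplex ℝ X | R ≤ mutualInfo P Q}, noiseExponent Q star P

end Information

/-- A sequential decoder `(τ, φ)` for `M` messages that observes outputs `Y_1, …, Y_N`; the output
at time `s` is the coordinate with index `s - 1`. The stopping time may be randomized: `τ w` is an
ordinary stopping time for each value `w` of an auxiliary variable with distribution `law`, which is
independent of everything else (`seeds = 1` is the deterministic case; as there are only finitely
many stopping times bounded by `N`, finitely many values are enough). The decision is a function of
the observed string `Y_1, …, Y_τ`. -/
structure SequentialDecoder (Y : Type*) (M N : ℕ) where
  seeds : ℕ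
  law : Fin seeds → ℝ
  law_mem : law ∈ stdSimplex ℝ (Fin seeds)
  τ : Fin seeds → (Fin N → Y) → ℕ
  one_le_τ : ∀ w y, 1 ≤ τ w y
  τ_le : ∀ w y, τ w y ≤ N
  /-- Whether `τ = t` is determined by the outputs up to time `t`. -/
  stopping : ∀ w t y y', (∀ i : Fin N, (i : ℕ) < t → y i = y' i) → τ w y = t → τ w y' = t
  φ : List Y → Fin M

/-- The message declared after the output sequence `y`, for the value `w` of the randomization. -/
def SequentialDecoder.decode {Y : Type*} {M N : ℕ} (d : SequentialDecoder Y M N)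
    (w : Fin d.seeds) (y : Fin N → Y) : Fin M :=
  d.φ ((List.ofFn y).take (d.τ w y))

/-- A code of blocklength `n`: at least two messages, a codeword for each, and the sequential
decoder. The receiver knows the asynchronism level `A ≥ 1` and has to stop by time `A + n - 1`, so
the decoder is given for each value of `A`; the codewords do not depend on `A`. -/
structure Code (X Y : Type*) (n : ℕ+) where
  M : ℕ
  two_le : 2 ≤ M
  codeword : Fin M → Fin n → X
  decoder : ∀ A : ℕ+, SequentialDecoder Y M (A + n - 1)

/-- The channel input at time `s` when the word `c` starts being sent at time `t`: the letters of
`c` at times `t, …, t + n - 1`, the no-input symbol `star` otherwise. -/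
def channelInput {X : Type*} {n : ℕ} (star : X) (c : Fin n → X) (t s : ℕ) : X :=
  if h : t ≤ s ∧ s < t + n then c ⟨s - t, by omega⟩ else star

/-- The probability that the outputs at times `1, …, N` are `y` when the word `c` starts being
sent at time `t`. -/
def outputProb {X Y : Type*} {n N : ℕ} (Q : X → Y → ℝ) (star : X) (c : Fin n → X) (t : ℕ)
    (y : Fin N → Y) : ℝ :=
  ∏ i : Fin N, Q (channelInput star c t (i + 1)) (y i)

namespace Code

variable {X Y : Type*} [Fintype Y] {n : ℕ+}

/-- The expectation `E_{m,t}` of a function of the decoder randomization and the channel outputs: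
message `m` starts being sent at time `t`, at asynchronism level `A`. -/
def expect (c : Code X Y n) (Q : X → Y → ℝ) (star : X) (A : ℕ+) (m : Fin c.M) (t : ℕ)
    (f : Fin (c.decoder A).seeds → (Fin (A + n - 1) → Y) → ℝ) : ℝ :=
  ∑ w, (c.decoder A).law w * ∑ y, outputProb Q star (c.codeword m) t y * f w y

open Classical in
/-- The maximum over the messages of the time-averaged error probability,
`max_m (1/A) ∑_{t=1}^A P_{m,t}(decoded message ≠ m)`. -/
def errorProb (c : Code X Y n) (Q : X → Y → ℝ) (star : X) (A : ℕ+) : ℝ :=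
  ⨆ m : Fin c.M, (∑ t ∈ Finset.Icc 1 (A : ℕ), c.expect Q star A m t
    fun w y => if (c.decoder A).decode w y ≠ m then 1 else 0) / (A : ℕ)

/-- The delay `Δ = max_m (1/A) ∑_{t=1}^A E_{m,t} (τ - t)^+`. -/
def delay (c : Code X Y n) (Q : X → Y → ℝ) (star : X) (A : ℕ+) : ℝ :=
  ⨆ m : Fin c.M, (∑ t ∈ Finset.Icc 1 (A : ℕ), c.expect Q star A m t
    fun w y => max (((c.decoder A).τ w y : ℝ) - t) 0) / (A : ℕ)

/-- The rate `ln M / Δ`, which is `∞` if `Δ = 0` (recall that `M ≥ 2`). -/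
def rate (c : Code X Y n) (Q : X → Y → ℝ) (star : X) (A : ℕ+) : ENNReal :=
  ENNReal.ofReal (Real.log c.M) / ENNReal.ofReal (c.delay Q star A)

end Code

/-- The integer asynchronism level `⌈e^{a n}⌉ ≥ 1`. -/
def asyncLevel (a : ℝ) (n : ℕ+) : ℕ+ :=
  ⟨⌈Real.exp (a * (n : ℕ))⌉₊, Nat.ceil_pos.mpr (Real.exp_pos _)⟩

/-- The pair `(R, α)`, with `R ≥ 0` and `α ≥ 0`, is achievable: there is a sequence of codes such
that for every `ε > 0` and all sufficiently large `n` the `n`-th code, operating at asynchronism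
level `e^{(α-ε)n}`, has rate at least `R - ε` and maximum error probability at most `ε`. -/
def Achievable {X Y : Type*} [Fintype Y] (Q : X → Y → ℝ) (star : X) (R α : ℝ) : Prop :=
  0 ≤ R ∧ 0 ≤ α ∧ ∃ c : ∀ n : ℕ+, Code X Y n, ∀ ε : ℝ, 0 < ε → ∃ n₀ : ℕ+, ∀ n : ℕ+, n₀ ≤ n →
    ENNReal.ofReal (R - ε) ≤ (c n).rate Q star (asyncLevel (α - ε) n) ∧
    (c n).errorProb Q star (asyncLevel (α - ε) n) ≤ ε

/-- The asynchronous capacity `α(R)`: the supremum, possibly `+∞`, of the asynchronism exponents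
that are achievable at rate `R`. -/
def asyncCapacity {X Y : Type*} [Fintype Y] (Q : X → Y → ℝ) (star : X) (R : ℝ) : EReal :=
  sSup ((fun α : ℝ => (α : EReal)) '' {α | Achievable Q star R α})

end AsyncComm

end

noncomputable section

open scoped BigOperators

namespace AsyncComm

/-! ### Mutual information: continuity, concavity, positivity. -/

section Information

variable {X Y : Type*} [Fintype X] [Fintype Y]

/-! The decoder slides a window of length `n` over the outputs and separates detecting the message
from decoding it.

Detection. Let `S` be the set of words whose type `V` satisfies `D(V‖Q_⋆) ≥ α`. By the method of
types (`prodProb_le_of_forall_le_divergence`) a pure-noise window lies in `S` with probability at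
most `(n+1)^|Y| e^{-nα}`. By hypothesis a type outside `S` has `D(V‖(PQ)_Y) ≥ α`, so the output of a
random codeword misses `S` with a probability obeying the same bound. At level about `e^{(α-δ)n}`
both the union bound over the noise windows and the expected delay caused by a miss (about `A` steps
times its probability) vanish.

Decoding. After an alarm the decoder waits until the likelihood ratio of some codeword in the
current window reaches `e^{n(I-η)}`, but no longer than `n-1` steps. About `e^{n(I-2η)}` random
codewords suffice: the true one passes the test by a Chernoff bound, and a wrong one, being
independent of the outputs, passes in a given window with probability at most `e^{-n(I-η)}`, even if
the window mixes noise with the codeword. Expurgation (`exists_expurgated`, `exists_codebook`) makes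
all these bounds hold for every message. The delay is then at most `n(1+δ)`, which gives the rate.

This needs `I > 0`; a slight move of `P` towards a capacity-achieving distribution ensures it, since
the noise exponent is lower semicontinuous (`exists_mutualInfo_pos`). A diagonal choice
(`exists_diagonal`) merges the codes for all margins into one sequence. The extrema are attained by
semicontinuity on compact simplices. -/

theorem outputDist_mem {P : X → ℝ} {Q : X → Y → ℝ} (hP : P ∈ stdSimplex ℝ X)
    (hQ : ∀ x, Q x ∈ stdSimplex ℝ Y) : outputDist P Q ∈ stdSimplex ℝ Y := by
  refine ⟨fun y => Finset.sum_nonneg fun x _ => mul_nonneg (hP.1 x) ((hQ x).1 y), ?_⟩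
  simp only [outputDist]
  rw [Finset.sum_comm]
  simp_rw [← Finset.mul_sum, (hQ _).2, mul_one]
  exact hP.2

theorem continuous_outputDist {X Y : Type*} [Fintype X] (Q : X → Y → ℝ) :
    Continuous fun P : X → ℝ => outputDist P Q := by
  unfold outputDist
  fun_prop

theorem mul_eq_zero_of_outputDist_eq_zero {P : X → ℝ} {Q : X → Y → ℝ} (hP : P ∈ stdSimplex ℝ X)
    (hQ : ∀ x, Q x ∈ stdSimplex ℝ Y) {y : Y} (h : outputDist P Q y = 0) (x : X) :
    P x * Q x y = 0 :=
  (Finset.sum_eq_zero_iff_of_nonneg fun x _ => mul_nonneg (hP.1 x) ((hQ x).1 y)).1 h x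
    (Finset.mem_univ x)

/-- The mutual information as a difference of entropies. -/
def entropyGap (P : X → ℝ) (Q : X → Y → ℝ) : ℝ :=
  ∑ y, Real.negMulLog (outputDist P Q y) - ∑ x, P x * ∑ y, Real.negMulLog (Q x y)

/-- Where `P x * Q x y` is nonzero the output probability is nonzero too, so the logarithm of the
quotient splits; the other terms vanish on both sides. Unlike `mutualInfo`, the right side is
visibly continuous on the whole space. -/
theorem mutualInfo_eq_entropyGap {P : X → ℝ} {Q : X → Y → ℝ} (hP : P ∈ stdSimplex ℝ X)
    (hQ : ∀ x, Q x ∈ stdSimplex ℝ Y) : mutualInfo P Q = entropyGap P Q := by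
  have h1 : ∀ x y, P x * (Q x y * Real.log (Q x y / outputDist P Q y)) =
      -(P x * Q x y * Real.log (outputDist P Q y)) - P x * Real.negMulLog (Q x y) := by
    intro x y
    by_cases h : P x * Q x y = 0
    · rcases mul_eq_zero.1 h with h | h <;> simp [h]
    · have hq : Q x y ≠ 0 := right_ne_zero_of_mul h
      have ho : outputDist P Q y ≠ 0 := fun h0 => h (mul_eq_zero_of_outputDist_eq_zero hP hQ h0 x)
      rw [Real.log_div hq ho, Real.negMulLog]
      ring
  simp only [mutualInfo, entropyGap, Finset.mul_sum, h1, Finset.sum_sub_distrib]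
  congr 1
  rw [Finset.sum_comm]
  refine Finset.sum_congr rfl fun y _ => ?_
  rw [Finset.sum_neg_distrib, ← Finset.sum_mul, Real.negMulLog]
  simp [outputDist]

theorem continuous_entropyGap (Q : X → Y → ℝ) : Continuous fun P : X → ℝ => entropyGap P Q := by
  unfold entropyGap
  have := continuous_outputDist Q
  have h (y : Y) : Continuous fun P : X → ℝ => outputDist P Q y := (continuous_apply y).comp this
  have h2 (y : Y) : Continuous fun P : X → ℝ => Real.negMulLog (outputDist P Q y) :=
    Real.continuous_negMulLog.comp (h y)
  fun_prop

theorem continuousOn_mutualInfo {Q : X → Y → ℝ} (hQ : ∀ x, Q x ∈ stdSimplex ℝ Y) :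
    ContinuousOn (fun P => mutualInfo P Q) (stdSimplex ℝ X) :=
  (continuous_entropyGap Q).continuousOn.congr fun _ hP => mutualInfo_eq_entropyGap hP hQ

/-- The output distribution is linear in `P`, the output entropy is concave in it, and the
subtracted conditional entropy is linear in `P`. -/
theorem concaveOn_mutualInfo {Q : X → Y → ℝ} (hQ : ∀ x, Q x ∈ stdSimplex ℝ Y) :
    ConcaveOn ℝ (stdSimplex ℝ X) fun P => mutualInfo P Q := by
  refine ⟨convex_stdSimplex ℝ X, fun P hP P' hP' a b ha hb hab => ?_⟩
  have hm := convex_stdSimplex ℝ X hP hP' ha hb hab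
  simp only [mutualInfo_eq_entropyGap hP hQ, mutualInfo_eq_entropyGap hP' hQ,
    mutualInfo_eq_entropyGap hm hQ, entropyGap, smul_eq_mul, Pi.add_apply, Pi.smul_apply]
  have h1 : ∀ y, a * Real.negMulLog (outputDist P Q y) + b * Real.negMulLog (outputDist P' Q y) ≤
      Real.negMulLog (outputDist (a • P + b • P') Q y) := by
    intro y
    have h := Real.concaveOn_negMulLog.2 ((outputDist_mem hP hQ).1 y) ((outputDist_mem hP' hQ).1 y)
      ha hb hab
    have h2 : outputDist (a • P + b • P') Q y = a • outputDist P Q y + b • outputDist P' Q y := by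
      simp only [outputDist, smul_eq_mul, Pi.add_apply, Pi.smul_apply, Finset.mul_sum,
        ← Finset.sum_add_distrib]
      exact Finset.sum_congr rfl fun x _ => by ring
    rw [h2]
    exact h
  have h2 := Finset.sum_le_sum fun y (_ : y ∈ Finset.univ) => h1 y
  rw [Finset.sum_add_distrib, ← Finset.mul_sum, ← Finset.mul_sum] at h2
  have h3 : ∑ x, (a * P x + b * P' x) * ∑ y, Real.negMulLog (Q x y) =
      a * ∑ x, P x * ∑ y, Real.negMulLog (Q x y) + b * ∑ x, P' x * ∑ y, Real.negMulLog (Q x y) := by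
    rw [Finset.mul_sum, Finset.mul_sum, ← Finset.sum_add_distrib]
    exact Finset.sum_congr rfl fun x _ => by ring
  rw [h3]
  linarith

theorem mutualInfo_nonneg {P : X → ℝ} {Q : X → Y → ℝ} (hP : P ∈ stdSimplex ℝ X)
    (hQ : ∀ x, Q x ∈ stdSimplex ℝ Y) : 0 ≤ mutualInfo P Q := by
  rw [mutualInfo_eq_entropyGap hP hQ, entropyGap, sub_nonneg]
  simp only [Finset.mul_sum]
  rw [Finset.sum_comm]
  refine Finset.sum_le_sum fun y _ => ?_
  have h := Real.concaveOn_negMulLog.le_map_sum (t := Finset.univ) (w := P) (p := fun x => Q x y)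
    (fun x _ => hP.1 x) hP.2 (fun x _ => (hQ x).1 y)
  simpa [outputDist] using h

theorem exists_mutualInfo_eq_syncCapacity [Nonempty X] {Q : X → Y → ℝ}
    (hQ : ∀ x, Q x ∈ stdSimplex ℝ Y) :
    ∃ P ∈ stdSimplex ℝ X, mutualInfo P Q = syncCapacity Q := by
  classical
  obtain ⟨P, hP, h⟩ := (isCompact_stdSimplex (𝕜 := ℝ) X).exists_sSup_image_eq
    ⟨_, single_mem_stdSimplex ℝ (Classical.arbitrary X)⟩ (continuousOn_mutualInfo hQ)
  exact ⟨P, hP, h.symm⟩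

end Information

/-! ### Semicontinuity of the divergence, attained extrema, perturbation of the input distribution.
-/

section Divergence

open Filter Topology

variable {X Y : Type*} [Fintype X] [Fintype Y]

/-- The divergence with the second argument truncated from below. -/
def truncDiv (k : ℕ) (V W : Y → ℝ) : ℝ :=
  ∑ y, (V y * Real.log (V y) - V y * Real.log (max (W y) (1 / ((k : ℝ) + 1))))

theorem continuous_truncDiv (k : ℕ) :
    Continuous fun p : (Y → ℝ) × (Y → ℝ) => truncDiv k p.1 p.2 := by
  have hk : (0 : ℝ) < 1 / ((k : ℝ) + 1) := Nat.one_div_pos_of_nat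
  have h1 (y : Y) : Continuous fun p : (Y → ℝ) × (Y → ℝ) => p.1 y := by fun_prop
  have h2 (y : Y) : Continuous fun p : (Y → ℝ) × (Y → ℝ) => p.1 y * Real.log (p.1 y) :=
    Real.continuous_mul_log.comp (h1 y)
  have h3 (y : Y) : Continuous fun p : (Y → ℝ) × (Y → ℝ) =>
      Real.log (max (p.2 y) (1 / ((k : ℝ) + 1))) :=
    Continuous.log (by fun_prop) fun p => (lt_max_of_lt_right hk).ne'
  unfold truncDiv
  fun_prop

theorem truncDiv_le_divergence (k : ℕ) {V W : Y → ℝ} (hV : ∀ y, 0 ≤ V y) (hW : ∀ y, 0 ≤ W y) :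
    (truncDiv k V W : EReal) ≤ divergence V W := by
  unfold divergence
  split_ifs with h
  · rw [EReal.coe_le_coe_iff]
    refine Finset.sum_le_sum fun y _ => ?_
    by_cases hv : V y = 0
    · simp [hv]
    have hw : W y ≠ 0 := fun h0 => hv (h y h0)
    rw [Real.log_div hv hw, mul_sub]
    have := Real.log_le_log (lt_of_le_of_ne (hW y) hw.symm)
      (le_max_left (W y) (1 / ((k : ℝ) + 1)))
    have := mul_le_mul_of_nonneg_left this (hV y)
    linarith
  · exact le_top

/-- The truncation is exact once `1 / (k + 1)` lies below every positive value of `W`; if `W y₀ = 0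
< V y₀`, the term at `y₀` grows like `V y₀ * log (k + 1)`. As a supremum of jointly continuous
functions the divergence is then jointly lower semicontinuous. -/
theorem divergence_eq_iSup {V W : Y → ℝ} (hV : ∀ y, 0 ≤ V y) (hW : W ∈ stdSimplex ℝ Y) :
    divergence V W = ⨆ k : ℕ, (truncDiv k V W : EReal) := by
  refine le_antisymm ?_ (iSup_le fun k => truncDiv_le_divergence k hV hW.1)
  unfold divergence
  split_ifs with h
  · have h1 : ∀ᶠ k : ℕ in atTop, ∀ y, W y ≠ 0 → 1 / ((k : ℝ) + 1) ≤ W y := by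
      rw [eventually_all]
      intro y
      by_cases hw : W y = 0
      · simp [hw]
      · filter_upwards [tendsto_one_div_add_atTop_nhds_zero_nat.eventually_le_const
          (lt_of_le_of_ne (hW.1 y) (Ne.symm hw))] with k hk _ using hk
    obtain ⟨k, hk⟩ := h1.exists
    refine le_iSup_of_le k ?_
    rw [EReal.coe_le_coe_iff]
    refine Finset.sum_le_sum fun y _ => ?_
    by_cases hv : V y = 0
    · simp [hv]
    have hw : W y ≠ 0 := fun h0 => hv (h y h0)
    rw [Real.log_div hv hw, mul_sub, max_eq_left (hk y hw)]
  · push Not at h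
    obtain ⟨y₀, hw, hv⟩ := h
    have hv0 : 0 < V y₀ := lt_of_le_of_ne (hV y₀) (Ne.symm hv)
    rw [top_le_iff, iSup_eq_top]
    intro b hb
    have hlim : Tendsto (fun k : ℕ => ∑ y, V y * Real.log (V y) +
        V y₀ * Real.log ((k : ℝ) + 1)) atTop atTop := by
      refine tendsto_atTop_add_const_left _ _ ?_
      refine Tendsto.const_mul_atTop hv0 ?_
      exact Real.tendsto_log_atTop.comp
        (tendsto_atTop_add_const_right _ _ tendsto_natCast_atTop_atTop)
    have hlb (k : ℕ) : ∑ y, V y * Real.log (V y) + V y₀ * Real.log ((k : ℝ) + 1) ≤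
        truncDiv k V W := by
      rw [truncDiv, Finset.sum_sub_distrib]
      have hk : (0 : ℝ) < 1 / ((k : ℝ) + 1) := Nat.one_div_pos_of_nat
      have hk1 : 1 / ((k : ℝ) + 1) ≤ 1 := by
        rw [div_le_one (by positivity)]; linarith [(Nat.cast_nonneg k : (0 : ℝ) ≤ k)]
      have hle : ∀ y, V y * Real.log (max (W y) (1 / ((k : ℝ) + 1))) ≤ 0 := fun y =>
        mul_nonpos_of_nonneg_of_nonpos (hV y) (Real.log_nonpos (le_max_of_le_right hk.le)
          (max_le (mem_Icc_of_mem_stdSimplex hW y).2 hk1))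
      -- The truncated values of `W` are at most `1`, so all these terms are nonpositive and only
      -- the one at `y₀` is kept.
      have h1 : ∑ y, V y * Real.log (max (W y) (1 / ((k : ℝ) + 1))) ≤
          V y₀ * Real.log (max (W y₀) (1 / ((k : ℝ) + 1))) := by
        classical
        rw [← Finset.add_sum_erase _ _ (Finset.mem_univ y₀)]
        have := Finset.sum_nonpos fun y (_ : y ∈ Finset.univ.erase y₀) => hle y
        linarith
      have h2 : Real.log (1 / ((k : ℝ) + 1)) = -Real.log ((k : ℝ) + 1) := by
        rw [one_div, Real.log_inv]
      rw [hw, max_eq_right hk.le, h2] at h1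
      linarith
    induction b with
    | bot => exact ⟨0, EReal.bot_lt_coe _⟩
    | top => exact absurd hb (lt_irrefl _)
    | coe b =>
      obtain ⟨k, hk⟩ := (hlim.eventually_gt_atTop b).exists
      exact ⟨k, EReal.coe_lt_coe_iff.2 (hk.trans_le (hlb k))⟩

theorem lowerSemicontinuous_iSup_truncDiv : LowerSemicontinuous
    fun p : (Y → ℝ) × (Y → ℝ) => ⨆ k : ℕ, (truncDiv k p.1 p.2 : EReal) :=
  lowerSemicontinuous_iSup fun k =>
    (continuous_coe_real_ereal.comp (continuous_truncDiv k)).lowerSemicontinuous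

/-- An everywhere lower semicontinuous extension of `maxDivergence`. -/
def lscMaxDiv (Q : X → Y → ℝ) (star : X) (p : (X → ℝ) × (Y → ℝ)) : EReal :=
  max (⨆ k : ℕ, (truncDiv k p.2 (outputDist p.1 Q) : EReal))
    (⨆ k : ℕ, (truncDiv k p.2 (Q star) : EReal))

theorem lowerSemicontinuous_lscMaxDiv (Q : X → Y → ℝ) (star : X) :
    LowerSemicontinuous (lscMaxDiv Q star) := by
  have ho := continuous_outputDist Q
  refine LowerSemicontinuous.sup
    (f := fun p : (X → ℝ) × (Y → ℝ) => ⨆ k : ℕ, (truncDiv k p.2 (outputDist p.1 Q) : EReal))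
    (g := fun p : (X → ℝ) × (Y → ℝ) => ⨆ k : ℕ, (truncDiv k p.2 (Q star) : EReal)) ?_ ?_
  · exact lowerSemicontinuous_iSup_truncDiv.comp
      (g := fun p : (X → ℝ) × (Y → ℝ) => (p.2, outputDist p.1 Q)) (by fun_prop)
  · exact lowerSemicontinuous_iSup_truncDiv.comp
      (g := fun p : (X → ℝ) × (Y → ℝ) => (p.2, Q star)) (by fun_prop)

theorem maxDivergence_eq_lscMaxDiv {Q : X → Y → ℝ} (hQ : ∀ x, Q x ∈ stdSimplex ℝ Y) (star : X)
    {P : X → ℝ} (hP : P ∈ stdSimplex ℝ X) {V : Y → ℝ} (hV : V ∈ stdSimplex ℝ Y) :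
    maxDivergence Q star P V = lscMaxDiv Q star (P, V) := by
  rw [maxDivergence, lscMaxDiv, divergence_eq_iSup hV.1 (outputDist_mem hP hQ),
    divergence_eq_iSup hV.1 (hQ star)]

theorem isLeast_noiseExponent {Q : X → Y → ℝ} (hQ : ∀ x, Q x ∈ stdSimplex ℝ Y) (star : X)
    {P : X → ℝ} (hP : P ∈ stdSimplex ℝ X) :
    IsLeast (maxDivergence Q star P '' stdSimplex ℝ Y) (noiseExponent Q star P) := by
  have hl : LowerSemicontinuousOn (fun V => lscMaxDiv Q star (P, V)) (stdSimplex ℝ Y) :=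
    ((lowerSemicontinuous_lscMaxDiv Q star).comp
      (g := fun V : Y → ℝ => (P, V)) (by fun_prop)).lowerSemicontinuousOn _
  obtain ⟨V, hV, hmin⟩ := hl.exists_isMinOn ⟨_, hQ star⟩ (isCompact_stdSimplex (𝕜 := ℝ) Y)
  have hle : ∀ V' ∈ stdSimplex ℝ Y, maxDivergence Q star P V ≤ maxDivergence Q star P V' := by
    intro V' hV'
    rw [maxDivergence_eq_lscMaxDiv hQ star hP hV, maxDivergence_eq_lscMaxDiv hQ star hP hV']
    exact hmin hV'
  have heq : noiseExponent Q star P = maxDivergence Q star P V :=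
    le_antisymm (iInf₂_le V hV) (le_iInf₂ hle)
  rw [heq]
  exact ⟨⟨V, hV, rfl⟩, by rintro _ ⟨V', hV', rfl⟩; exact hle V' hV'⟩

theorem divergence_nonneg {V W : Y → ℝ} (hV : V ∈ stdSimplex ℝ Y) (hW : W ∈ stdSimplex ℝ Y) :
    0 ≤ divergence V W := by
  unfold divergence
  split_ifs with h
  · rw [EReal.coe_nonneg]
    have h1 : ∀ y, V y - W y ≤ V y * Real.log (V y / W y) := by
      intro y
      by_cases hv : V y = 0
      · simp [hv, hW.1 y]
      have hw : W y ≠ 0 := fun h0 => hv (h y h0)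
      have hv0 : 0 < V y := lt_of_le_of_ne (hV.1 y) (Ne.symm hv)
      have hw0 : 0 < W y := lt_of_le_of_ne (hW.1 y) (Ne.symm hw)
      have h2 := Real.one_sub_inv_le_log_of_pos (div_pos hv0 hw0)
      have h3 := mul_le_mul_of_nonneg_left h2 hv0.le
      have h4 : V y * (1 - (V y / W y)⁻¹) = V y - W y := by field_simp
      linarith
    have h2 := Finset.sum_le_sum fun y (_ : y ∈ Finset.univ) => h1 y
    rw [Finset.sum_sub_distrib, hV.2, hW.2, sub_self] at h2
    exact h2
  · exact le_top

theorem noiseExponent_nonneg {Q : X → Y → ℝ} (hQ : ∀ x, Q x ∈ stdSimplex ℝ Y) (star : X)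
    (P : X → ℝ) : 0 ≤ noiseExponent Q star P :=
  le_iInf₂ fun _ hV => le_max_of_le_right (divergence_nonneg hV (hQ star))

/-- Where the divergence is finite, `W` is positive on the support of `V`; this persists nearby, and
the finite formula is continuous there. Where it is infinite there is nothing to prove. -/
theorem upperSemicontinuousOn_divergence_right (V : Y → ℝ) :
    UpperSemicontinuousOn (divergence V) (stdSimplex ℝ Y) := by
  intro W hW c hc
  by_cases h : ∀ y, W y = 0 → V y = 0
  · have hpos : ∀ᶠ W' in 𝓝 W, ∀ y, W' y = 0 → V y = 0 := by
      rw [eventually_all]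
      intro y
      by_cases hw : W y = 0
      · simp [h y hw]
      · have : ContinuousAt (fun W' : Y → ℝ => W' y) W := (continuous_apply y).continuousAt
        filter_upwards [this.eventually_ne hw] with W' h1 h2 using absurd h2 h1
    have hcont : ContinuousAt
        (fun W' : Y → ℝ => ((∑ y, V y * Real.log (V y / W' y) : ℝ) : EReal)) W := by
      refine continuous_coe_real_ereal.continuousAt.comp ?_
      refine tendsto_finsetSum _ fun y _ => ?_
      by_cases hv : V y = 0
      · simp only [hv, zero_mul]
        exact tendsto_const_nhds
      · have hw : W y ≠ 0 := fun h0 => hv (h y h0)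
        have h1 : ContinuousAt (fun W' : Y → ℝ => V y / W' y) W :=
          ContinuousAt.div (by fun_prop) (continuous_apply y).continuousAt hw
        exact (ContinuousAt.mul (by fun_prop) (h1.log (div_ne_zero hv hw)))
    rw [divergence, if_pos h] at hc
    refine Filter.Eventually.filter_mono nhdsWithin_le_nhds ?_
    filter_upwards [hpos, hcont.eventually_lt continuousAt_const hc] with W' h1 h2
    rwa [divergence, if_pos h1]
  · rw [divergence, if_neg h] at hc
    exact absurd hc not_top_lt

/-- An infimum of upper semicontinuous functions of `P` is upper semicontinuous; this is what lets
the maximum over `P` be attained. -/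
theorem upperSemicontinuousOn_noiseExponent {Q : X → Y → ℝ} (hQ : ∀ x, Q x ∈ stdSimplex ℝ Y)
    (star : X) : UpperSemicontinuousOn (noiseExponent Q star) (stdSimplex ℝ X) := by
  refine upperSemicontinuousOn_biInf (f := fun V _ P => maxDivergence Q star P V) fun V _ => ?_
  refine UpperSemicontinuousOn.sup ?_ ?_
  · exact (upperSemicontinuousOn_divergence_right V).comp
      (continuous_outputDist Q).continuousOn fun P hP => outputDist_mem hP hQ
  · exact upperSemicontinuousOn_const

theorem isGreatest_alphaMinus {Q : X → Y → ℝ} (hQ : ∀ x, Q x ∈ stdSimplex ℝ Y) (star : X) {R : ℝ}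
    (hR : R ≤ syncCapacity Q) :
    IsGreatest (noiseExponent Q star '' {P ∈ stdSimplex ℝ X | R ≤ mutualInfo P Q})
      (alphaMinus Q star R) := by
  have : Nonempty X := ⟨star⟩
  have hset : {P ∈ stdSimplex ℝ X | R ≤ mutualInfo P Q} =
      stdSimplex ℝ X ∩ {P | R ≤ entropyGap P Q} := by
    ext P
    simp only [Set.mem_ofPred_eq, Set.mem_inter_iff]
    exact and_congr_right fun hP => by rw [mutualInfo_eq_entropyGap hP hQ]
  have hcomp : IsCompact {P ∈ stdSimplex ℝ X | R ≤ mutualInfo P Q} := by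
    rw [hset]
    exact (isCompact_stdSimplex (𝕜 := ℝ) X).inter_right
      (isClosed_le continuous_const (continuous_entropyGap Q))
  obtain ⟨P₀, hP₀, hc⟩ := exists_mutualInfo_eq_syncCapacity hQ
  have husc : UpperSemicontinuousOn (noiseExponent Q star)
      {P ∈ stdSimplex ℝ X | R ≤ mutualInfo P Q} :=
    (upperSemicontinuousOn_noiseExponent hQ star).mono fun P hP => hP.1
  have hne : {P ∈ stdSimplex ℝ X | R ≤ mutualInfo P Q}.Nonempty := ⟨P₀, hP₀, hR.trans_eq hc.symm⟩
  obtain ⟨P, hP, hmax⟩ := husc.exists_isMaxOn hne hcomp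
  have heq : alphaMinus Q star R = noiseExponent Q star P :=
    le_antisymm (iSup₂_le fun P' hP' => hmax hP') (le_iSup₂_of_le P hP le_rfl)
  rw [heq]
  exact ⟨⟨P, hP, rfl⟩, by rintro _ ⟨P', hP', rfl⟩; exact hmax hP'⟩

/-- The noise exponent is lower semicontinuous. -/
theorem eventually_lt_maxDivergence {Q : X → Y → ℝ} (hQ : ∀ x, Q x ∈ stdSimplex ℝ Y) (star : X)
    {P : X → ℝ} (hP : P ∈ stdSimplex ℝ X) {a : EReal}
    (h : ∀ V ∈ stdSimplex ℝ Y, a < maxDivergence Q star P V) :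
    ∀ᶠ P' in 𝓝[stdSimplex ℝ X] P, ∀ V ∈ stdSimplex ℝ Y, a < maxDivergence Q star P' V := by
  have hclosed : IsClosed {p | lscMaxDiv Q star p ≤ a} :=
    (lowerSemicontinuous_lscMaxDiv Q star).isClosed_preimage a
  -- The pairs `(P', V)` violating the strict bound form a compact set; its projection to `P'` is
  -- closed and misses `P`.
  have hcomp : IsCompact ((stdSimplex ℝ X ×ˢ stdSimplex ℝ Y) ∩ {p | lscMaxDiv Q star p ≤ a}) :=
    ((isCompact_stdSimplex (𝕜 := ℝ) X).prod (isCompact_stdSimplex (𝕜 := ℝ) Y)).inter_right hclosed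
  have hproj := (hcomp.image continuous_fst).isClosed
  have hnot : P ∉ Prod.fst ''
      ((stdSimplex ℝ X ×ˢ stdSimplex ℝ Y) ∩ {p | lscMaxDiv Q star p ≤ a}) := by
    rintro ⟨⟨P', V⟩, ⟨⟨_, hV⟩, hle⟩, rfl⟩
    have := h V hV
    rw [maxDivergence_eq_lscMaxDiv hQ star hP hV] at this
    exact absurd hle (not_le.2 this)
  filter_upwards [nhdsWithin_le_nhds (hproj.isOpen_compl.mem_nhds hnot), self_mem_nhdsWithin]
    with P' hP' hP's V hV
  by_contra hle
  rw [not_lt, maxDivergence_eq_lscMaxDiv hQ star hP's hV] at hle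
  exact hP' ⟨(P', V), ⟨⟨hP's, hV⟩, hle⟩, rfl⟩

/-- An input distribution can be perturbed so that its mutual information becomes positive, at an
arbitrarily small loss of mutual information and noise exponent. -/
theorem exists_mutualInfo_pos {Q : X → Y → ℝ} (hQ : ∀ x, Q x ∈ stdSimplex ℝ Y) (star : X)
    (hC : 0 < syncCapacity Q) {P : X → ℝ} (hP : P ∈ stdSimplex ℝ X) {α : ℝ}
    (hα : ∀ V ∈ stdSimplex ℝ Y, (α : EReal) ≤ divergence V (outputDist P Q) ∨
      (α : EReal) ≤ divergence V (Q star)) {δ : ℝ} (hδ : 0 < δ) :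
    ∃ P' ∈ stdSimplex ℝ X, 0 < mutualInfo P' Q ∧ mutualInfo P Q - δ ≤ mutualInfo P' Q ∧
      ∀ V ∈ stdSimplex ℝ Y, ((α - δ : ℝ) : EReal) ≤ divergence V (outputDist P' Q) ∨
        ((α - δ : ℝ) : EReal) ≤ divergence V (Q star) := by
  have : Nonempty X := ⟨star⟩
  obtain ⟨P₀, hP₀, hc⟩ := exists_mutualInfo_eq_syncCapacity hQ
  have hev := eventually_lt_maxDivergence hQ star hP (a := ((α - δ : ℝ) : EReal)) fun V hV => by
    refine lt_of_lt_of_le (EReal.coe_lt_coe_iff.2 (sub_lt_self α hδ)) ?_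
    rcases hα V hV with h | h
    · exact le_max_of_le_left h
    · exact le_max_of_le_right h
  have hev2 : ∀ᶠ P' in 𝓝[stdSimplex ℝ X] P, mutualInfo P Q - δ < mutualInfo P' Q :=
    (continuousOn_mutualInfo hQ P hP).eventually_const_lt (sub_lt_self _ hδ)
  -- Along the segment from `P` to the capacity-achieving `P₀`, concavity gives mutual information
  -- at least `r * C > 0` for every `r` in `(0, 1)`, while small `r` keeps both losses below `δ`.
  have hpath : Tendsto (fun r : ℝ => (1 - r) • P + r • P₀) (𝓝[>] 0) (𝓝[stdSimplex ℝ X] P) := by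
    refine tendsto_nhdsWithin_iff.2 ⟨?_, ?_⟩
    · have hcont : Continuous fun r : ℝ => (1 - r) • P + r • P₀ := by fun_prop
      have := (hcont.tendsto 0).mono_left (nhdsWithin_le_nhds (s := Set.Ioi 0))
      simpa using this
    · filter_upwards [Ioo_mem_nhdsGT (zero_lt_one (α := ℝ))] with r hr
      exact convex_stdSimplex ℝ X hP hP₀ (by linarith [hr.2]) hr.1.le (by ring)
  obtain ⟨r, ⟨h1, h2⟩, hr⟩ := ((hpath.eventually (hev.and hev2)).and
    (Ioo_mem_nhdsGT (zero_lt_one (α := ℝ)))).exists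
  refine ⟨_, convex_stdSimplex ℝ X hP hP₀ (by linarith [hr.2]) hr.1.le (by ring), ?_, h2.le,
    fun V hV => ?_⟩
  · have h := (concaveOn_mutualInfo hQ).2 hP hP₀ (by linarith [hr.2] : 0 ≤ 1 - r) hr.1.le (by ring)
    simp only [smul_eq_mul, hc] at h
    have h3 := mul_nonneg (by linarith [hr.2] : 0 ≤ 1 - r) (mutualInfo_nonneg hP hQ)
    have h4 := mul_pos hr.1 hC
    linarith
  · exact (lt_max_iff.1 (h1 V hV)).imp le_of_lt le_of_lt

end Divergence

/-! ### Product distributions and their marginals. -/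

section ProductSums

variable {ι κ B : Type*} [Fintype ι] [DecidableEq ι] [Fintype κ] [DecidableEq κ] [Fintype B]

theorem sum_prod_eq_prod_sum (p : ι → B → ℝ) : ∑ y : ι → B, ∏ i, p i (y i) = ∏ i, ∑ b, p i b := by
  classical
  rw [Finset.prod_univ_sum, Fintype.piFinset_univ]

/-- The marginal of a product distribution along an injection of the index sets. -/
theorem sum_prod_mul_comp (p : ι → B → ℝ) (hp : ∀ i, ∑ b, p i b = 1) {e : κ → ι}
    (he : Function.Injective e) (f : (κ → B) → ℝ) :
    ∑ y : ι → B, (∏ i, p i (y i)) * f (y ∘ e) = ∑ z : κ → B, (∏ k, p (e k) (z k)) * f z := by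
  classical
  -- The indicator of `y ∘ e = z` factors over coordinates: those in the range of `e` are pinned,
  -- and the others sum to one.
  have h1 (z : κ → B) : ∑ y : ι → B, (∏ i, p i (y i)) * (if y ∘ e = z then 1 else 0) =
      ∏ k, p (e k) (z k) := by
    have h2 (y : ι → B) : (∏ i, p i (y i)) * (if y ∘ e = z then (1 : ℝ) else 0) =
        ∏ i, p i (y i) * (if ∀ k, e k = i → y i = z k then (1 : ℝ) else 0) := by
      rw [Finset.prod_mul_distrib]
      congr 1
      rw [Finset.prod_ite_zero]
      simp only [Finset.prod_const_one, Finset.mem_univ, true_implies]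
      refine if_congr ?_ rfl rfl
      rw [funext_iff]
      constructor
      · rintro h i k rfl
        exact h k
      · exact fun h k => h _ k rfl
    simp_rw [h2]
    rw [sum_prod_eq_prod_sum fun i b => p i b * (if ∀ k, e k = i → b = z k then (1 : ℝ) else 0)]
    symm
    refine Fintype.prod_of_injective e he _ _ ?_ ?_
    · intro i hi
      have : ∀ b, ∀ k, e k = i → b = z k := fun b k hk => absurd ⟨k, hk⟩ hi
      refine Eq.trans ?_ (hp i)
      exact Finset.sum_congr rfl fun b _ => by rw [if_pos (this b), mul_one]
    · intro k
      have h3 (b : B) : (∀ k', e k' = e k → b = z k') ↔ b = z k :=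
        ⟨fun h => h k rfl, fun h k' hk' => he hk' ▸ h⟩
      simp [h3]
  have h4 (y : ι → B) : f (y ∘ e) = ∑ z, (if y ∘ e = z then 1 else 0) * f z := by simp
  simp_rw [h4, Finset.mul_sum]
  rw [Finset.sum_comm]
  refine Finset.sum_congr rfl fun z _ => ?_
  rw [← h1 z, Finset.sum_mul]
  exact Finset.sum_congr rfl fun y _ => by ring

theorem sum_prod_mul_apply (p : ι → B → ℝ) (hp : ∀ i, ∑ b, p i b = 1) (i : ι) (f : B → ℝ) :
    ∑ y : ι → B, (∏ j, p j (y j)) * f (y i) = ∑ b, p i b * f b := by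
  have h := sum_prod_mul_comp p hp (e := fun _ : Unit => i) (fun _ _ _ => rfl) (fun z => f (z ()))
  simp only [Function.comp_apply, Finset.univ_unique, Finset.prod_singleton] at h
  rw [h]
  exact Fintype.sum_equiv (Equiv.funUnique Unit B) _ _ fun z => rfl

theorem sum_prod_mul_apply₂ (p : ι → B → ℝ) (hp : ∀ i, ∑ b, p i b = 1) {i i' : ι} (h : i ≠ i')
    (f : B → B → ℝ) :
    ∑ y : ι → B, (∏ j, p j (y j)) * f (y i) (y i') = ∑ b, p i b * ∑ b', p i' b' * f b b' := by
  have he : Function.Injective ![i, i'] := by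
    intro a b
    fin_cases a <;> fin_cases b <;> simp [h, h.symm]
  have h := sum_prod_mul_comp p hp he (fun z => f (z 0) (z 1))
  simp only [Function.comp_apply, Fin.prod_univ_two, Matrix.cons_val_zero, Matrix.cons_val_one] at h
  rw [h]
  simp only [Finset.mul_sum, ← mul_assoc]
  rw [← Fintype.sum_prod_type']
  exact Fintype.sum_equiv (finTwoArrowEquiv B) _ _ fun z => rfl

/-- The probability of a set of words under a product distribution. -/
def prodProb (p : ι → B → ℝ) (S : Set (ι → B)) : ℝ :=
  ∑ y : ι → B, (∏ i, p i (y i)) * S.indicator 1 y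

theorem prodProb_nonneg {p : ι → B → ℝ} (hp : ∀ i, p i ∈ stdSimplex ℝ B) (S : Set (ι → B)) :
    0 ≤ prodProb p S :=
  Finset.sum_nonneg fun _ _ => mul_nonneg (Finset.prod_nonneg fun i _ => (hp i).1 _)
    (Set.indicator_nonneg (fun _ _ => zero_le_one) _)

theorem prodProb_empty (p : ι → B → ℝ) : prodProb p ∅ = 0 := by simp [prodProb]

theorem sum_prod_eq_one {p : ι → B → ℝ} (hp : ∀ i, p i ∈ stdSimplex ℝ B) :
    ∑ y : ι → B, ∏ i, p i (y i) = 1 := by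
  rw [sum_prod_eq_prod_sum]
  exact Finset.prod_eq_one fun i _ => (hp i).2

theorem prodProb_mono {p : ι → B → ℝ} (hp : ∀ i, p i ∈ stdSimplex ℝ B) {S T : Set (ι → B)}
    (h : S ⊆ T) : prodProb p S ≤ prodProb p T :=
  Finset.sum_le_sum fun y _ => mul_le_mul_of_nonneg_left
    (Set.indicator_le_indicator_of_subset h (fun _ => zero_le_one' ℝ) y)
    (Finset.prod_nonneg fun i _ => (hp i).1 _)

theorem prodProb_preimage_comp (p : ι → B → ℝ) (hp : ∀ i, p i ∈ stdSimplex ℝ B) {e : κ → ι}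
    (he : Function.Injective e) (S : Set (κ → B)) :
    prodProb p {y | y ∘ e ∈ S} = prodProb (fun k => p (e k)) S :=
  sum_prod_mul_comp p (fun i => (hp i).2) he (S.indicator 1)

end ProductSums

/-! ### The method of types. -/

section Types

variable {B : Type*} [Fintype B] {n : ℕ}

open Classical in
/-- The empirical distribution of a word. -/
def wordType (z : Fin n → B) (b : B) : ℝ :=
  (Finset.univ.filter fun i => z i = b).card / (n : ℝ)

theorem wordType_mem (hn : 0 < n) (z : Fin n → B) : wordType z ∈ stdSimplex ℝ B := by
  classical
  refine ⟨fun b => by unfold wordType; positivity, ?_⟩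
  have h : ∑ b, (Finset.univ.filter fun i => z i = b).card = n := by
    rw [← Finset.card_eq_sum_card_fiberwise (f := z) (fun _ _ => Finset.mem_coe.2 (Finset.mem_univ _))]
    simp
  have hn' : (n : ℝ) ≠ 0 := by positivity
  simp only [wordType, ← Finset.sum_div]
  rw [div_eq_one_iff_eq hn']
  exact_mod_cast h

theorem wordType_pos {B : Type*} (z : Fin n → B) (i : Fin n) : 0 < wordType z (z i) := by
  have hn : 0 < n := i.pos
  classical
  unfold wordType
  have : 0 < (Finset.univ.filter fun j => z j = z i).card :=
    Finset.card_pos.2 ⟨i, by simp⟩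
  positivity

theorem sum_comp_eq_wordType (hn : 0 < n) (z : Fin n → B) (f : B → ℝ) :
    ∑ i, f (z i) = n * ∑ b, wordType z b * f b := by
  classical
  have hn' : (n : ℝ) ≠ 0 := by positivity
  rw [← Finset.sum_fiberwise (g := z), Finset.mul_sum]
  refine Finset.sum_congr rfl fun b _ => ?_
  rw [Finset.sum_congr rfl (g := fun _ => f b) (fun i hi => by rw [(Finset.mem_filter.1 hi).2]),
    Finset.sum_const, nsmul_eq_mul, wordType]
  field_simp

/-- When `W` is positive on the letters of `z`, the ratio of the probabilities of `z` under its own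
type and under `W` is exactly `e^{nD}`, with `D` the divergence of the type from `W`; otherwise the
left side is zero. -/
theorem prod_le_of_le_divergence (hn : 0 < n) {W : B → ℝ} (hW : ∀ b, 0 ≤ W b) {a : ℝ}
    {z : Fin n → B} (hz : (a : EReal) ≤ divergence (wordType z) W) :
    ∏ i, W (z i) ≤ Real.exp (-(n * a)) * ∏ i, wordType z (z i) := by
  have hpos : 0 < ∏ i, wordType z (z i) := Finset.prod_pos fun i _ => wordType_pos z i
  by_cases h0 : ∃ i, W (z i) = 0
  · obtain ⟨i, hi⟩ := h0
    rw [Finset.prod_eq_zero (Finset.mem_univ i) hi]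
    positivity
  push Not at h0
  have hac : ∀ b, W b = 0 → wordType z b = 0 := by
    intro b hb
    have hne : ∀ i, z i ≠ b := fun i h => h0 i (h ▸ hb)
    simp [wordType, hne]
  rw [divergence, if_pos hac, EReal.coe_le_coe_iff] at hz
  have hWp : ∀ i, 0 < W (z i) := fun i => lt_of_le_of_ne (hW _) (Ne.symm (h0 i))
  have h1 := sum_comp_eq_wordType hn z fun b => Real.log (wordType z b / W b)
  have h2 : ∏ i, wordType z (z i) = Real.exp (∑ i, Real.log (wordType z (z i) / W (z i))) *
      ∏ i, W (z i) := by
    rw [Real.exp_sum, ← Finset.prod_mul_distrib]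
    refine Finset.prod_congr rfl fun i _ => ?_
    rw [Real.exp_log (div_pos (wordType_pos z i) (hWp i)), div_mul_cancel₀ _ (h0 i)]
  rw [h2, ← mul_assoc, ← Real.exp_add]
  refine le_mul_of_one_le_left (Finset.prod_nonneg fun i _ => hW _) (Real.one_le_exp ?_)
  rw [h1]
  have := mul_le_mul_of_nonneg_left hz (Nat.cast_nonneg (α := ℝ) n)
  linarith

/-- Words with the same letter counts share their type, so each class contributes at most the total
mass `1` of one product distribution; there are at most `(n + 1) ^ |B|` count vectors. -/
theorem sum_prod_wordType_le (hn : 0 < n) :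
    ∑ z : Fin n → B, ∏ i, wordType z (z i) ≤ ((n : ℝ) + 1) ^ Fintype.card B := by
  classical
  let N : (Fin n → B) → B → Fin (n + 1) := fun z b =>
    ⟨(Finset.univ.filter fun i => z i = b).card,
      Nat.lt_succ_of_le ((Finset.card_le_univ _).trans_eq (Fintype.card_fin n))⟩
  have hN : ∀ z z', N z = N z' → wordType z = wordType z' := by
    intro z z' h
    funext b
    have := congrArg Fin.val (congrFun h b)
    simp only [N] at this
    simp only [wordType]
    rw [this]
  rw [← Finset.sum_fiberwise (g := N)]
  have hle : ∀ k : B → Fin (n + 1),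
      ∑ z ∈ Finset.univ.filter (fun z => N z = k), ∏ i, wordType z (z i) ≤ 1 := by
    intro k
    rcases (Finset.univ.filter fun z => N z = k).eq_empty_or_nonempty with h | ⟨z₀, hz₀⟩
    · rw [h]; simp
    · have h1 : ∀ z ∈ Finset.univ.filter (fun z => N z = k),
          ∏ i, wordType z (z i) = ∏ i, wordType z₀ (z i) := by
        intro z hz
        rw [hN z z₀ ((Finset.mem_filter.1 hz).2.trans (Finset.mem_filter.1 hz₀).2.symm)]
      rw [Finset.sum_congr rfl h1, ← sum_prod_eq_one (ι := Fin n) fun _ => wordType_mem hn z₀]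
      exact Finset.sum_le_sum_of_subset_of_nonneg (Finset.filter_subset _ _) fun z _ _ =>
        Finset.prod_nonneg fun i _ => (wordType_mem hn z₀).1 _
  calc _ ≤ ∑ k : B → Fin (n + 1), (1 : ℝ) := Finset.sum_le_sum fun k _ => hle k
    _ = _ := by simp

/-- The words whose type has divergence at least `a` from `W` have probability at most
`(n + 1) ^ |B| e^{-na}` under `W`. -/
theorem prodProb_le_of_forall_le_divergence (hn : 0 < n) {W : B → ℝ} (hW : W ∈ stdSimplex ℝ B)
    {a : ℝ} {S : Set (Fin n → B)} (hS : ∀ z ∈ S, (a : EReal) ≤ divergence (wordType z) W) :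
    prodProb (fun _ => W) S ≤ ((n : ℝ) + 1) ^ Fintype.card B * Real.exp (-(n * a)) := by
  calc prodProb (fun _ => W) S
      ≤ ∑ z : Fin n → B, Real.exp (-(n * a)) * ∏ i, wordType z (z i) := by
        refine Finset.sum_le_sum fun z _ => ?_
        by_cases hz : z ∈ S
        · simpa [hz] using prod_le_of_le_divergence hn hW.1 (hS z hz)
        · rw [Set.indicator_of_notMem hz, mul_zero]
          exact mul_nonneg (Real.exp_pos _).le (Finset.prod_nonneg fun i _ => (wordType_mem hn z).1 _)
    _ ≤ _ := by
        rw [← Finset.mul_sum, mul_comm]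
        exact mul_le_mul_of_nonneg_right (sum_prod_wordType_le hn) (Real.exp_pos _).le

end Types

/-! ### Selecting good codewords from a random codebook. -/

section Expurgation

theorem exists_le_of_weighted_sum_le {ι : Type*} [Fintype ι] {w : ι → ℝ} (hw : w ∈ stdSimplex ℝ ι)
    {f : ι → ℝ} {s : ℝ} (h : ∑ i, w i * f i ≤ s) : ∃ i, f i ≤ s := by
  by_contra! hlt
  obtain ⟨i, hi⟩ : ∃ i, w i ≠ 0 := by
    by_contra! h0
    have := hw.2
    simp [h0] at this
  have h1 : ∑ i, w i * s < ∑ i, w i * f i :=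
    Finset.sum_lt_sum (fun j _ => mul_le_mul_of_nonneg_left (hlt j).le (hw.1 j))
      ⟨i, Finset.mem_univ i, mul_lt_mul_of_pos_left (hlt i) (lt_of_le_of_ne (hw.1 i) (Ne.symm hi))⟩
  rw [← Finset.sum_mul, hw.2, one_mul] at h1
  exact absurd h (not_le.2 h1)

/-- Random coding with expurgation: `g` measures how bad a word is by itself, `h c c'` how likely
`c` is to be confused with `c'`. -/
theorem exists_expurgated {W : Type*} [Fintype W] {w : W → ℝ} (hw : w ∈ stdSimplex ℝ W)
    {g : W → ℝ} {h : W → W → ℝ} (hg : ∀ c, 0 ≤ g c) (hh : ∀ c c', 0 ≤ h c c') (M : ℕ) {a b s : ℝ}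
    (ha : ∑ c, w c * g c ≤ a) (hb : ∑ c, w c * ∑ c', w c' * h c c' ≤ b) (hb0 : 0 ≤ b)
    (hs : a + 2 * M * b ≤ s) (hs0 : 0 < s) :
    ∃ C : Fin M → W, ∀ m, g (C m) + ∑ m' ∈ Finset.univ.erase m, h (C m) (C m') ≤ 2 * s := by
  classical
  -- Twice as many words as needed are drawn, so that the worse half can be discarded.
  let bad : (Fin (2 * M) → W) → Fin (2 * M) → ℝ := fun C m =>
    g (C m) + ∑ m' ∈ Finset.univ.erase m, h (C m) (C m')
  have hmean : ∀ m, ∑ C : Fin (2 * M) → W, (∏ i, w (C i)) * bad C m ≤ s := by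
    intro m
    simp only [bad, mul_add, Finset.sum_add_distrib, Finset.mul_sum]
    rw [sum_prod_mul_apply (fun _ => w) (fun _ => hw.2) m g, Finset.sum_comm]
    have h1 : ∀ m' ∈ Finset.univ.erase m,
        ∑ C : Fin (2 * M) → W, (∏ i, w (C i)) * h (C m) (C m') ≤ b := by
      intro m' hm'
      rw [sum_prod_mul_apply₂ (fun _ => w) (fun _ => hw.2) (Finset.ne_of_mem_erase hm').symm h]
      exact hb
    have h2 := Finset.sum_le_card_nsmul _ _ _ h1
    have h3 : ((Finset.univ.erase m).card : ℝ) ≤ 2 * M := by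
      have : (Finset.univ.erase m).card ≤ 2 * M := (Finset.card_erase_le).trans (by simp)
      exact_mod_cast this
    rw [nsmul_eq_mul] at h2
    have h4 := mul_le_mul_of_nonneg_right h3 hb0
    linarith
  have htot : ∑ C : Fin (2 * M) → W, (∏ i, w (C i)) * ∑ m, bad C m ≤ 2 * M * s := by
    simp only [Finset.mul_sum]
    rw [Finset.sum_comm]
    refine (Finset.sum_le_card_nsmul _ _ s fun m _ => hmean m).trans (le_of_eq ?_)
    simp
  have hprod : (fun C : Fin (2 * M) → W => ∏ i, w (C i)) ∈ stdSimplex ℝ (Fin (2 * M) → W) :=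
    ⟨fun C => Finset.prod_nonneg fun i _ => hw.1 _, sum_prod_eq_one fun _ => hw⟩
  obtain ⟨C, hC⟩ := exists_le_of_weighted_sum_le hprod htot
  have hbad0 : ∀ m, 0 ≤ bad C m := fun m =>
    add_nonneg (hg _) (Finset.sum_nonneg fun _ _ => hh _ _)
  let G : Finset (Fin (2 * M)) := Finset.univ.filter fun m => bad C m ≤ 2 * s
  -- Markov's inequality: the total badness is at most `2 * M * s`, so at most `M` words exceed `2 *
  -- s`. Discarding words only removes nonnegative confusion terms from the others.
  have hcard : M ≤ G.card := by
    have h1 : ((Finset.univ.filter fun m => ¬ bad C m ≤ 2 * s).card : ℝ) * (2 * s) ≤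
        2 * M * s := by
      refine le_trans ?_ hC
      rw [← nsmul_eq_mul]
      refine (Finset.card_nsmul_le_sum _ (bad C) _ fun m hm =>
        (not_le.1 (Finset.mem_filter.1 hm).2).le).trans ?_
      exact Finset.sum_le_sum_of_subset_of_nonneg (Finset.filter_subset _ _) fun m _ _ => hbad0 m
    have h2 : (Finset.univ.filter fun m => ¬ bad C m ≤ 2 * s).card ≤ M := by
      have : ((Finset.univ.filter fun m => ¬ bad C m ≤ 2 * s).card : ℝ) ≤ M := by
        nlinarith
      exact_mod_cast this
    have h3 := Finset.card_filter_add_card_filter_not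
      (s := (Finset.univ : Finset (Fin (2 * M)))) (fun m => bad C m ≤ 2 * s)
    simp only [Finset.card_univ, Fintype.card_fin] at h3
    have : G.card = (Finset.univ.filter fun m => bad C m ≤ 2 * s).card := rfl
    omega
  let e : Fin M → Fin (2 * M) := G.orderEmbOfCardLe hcard
  have he : Function.Injective e := (G.orderEmbOfCardLe hcard).injective
  have heG : ∀ m, bad C (e m) ≤ 2 * s := fun m =>
    (Finset.mem_filter.1 (Finset.orderEmbOfCardLe_mem G hcard m)).2
  refine ⟨C ∘ e, fun m => le_trans ?_ (heG m)⟩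
  simp only [bad, Function.comp_apply]
  gcongr
  rw [← Finset.sum_image (s := Finset.univ.erase m) (g := e) (f := fun m' => h (C (e m)) (C m'))
    he.injOn]
  refine Finset.sum_le_sum_of_subset_of_nonneg ?_ fun _ _ _ => hh _ _
  intro m' hm'
  obtain ⟨k, hk, rfl⟩ := Finset.mem_image.1 hm'
  exact Finset.mem_erase.2 ⟨he.ne (Finset.ne_of_mem_erase hk), Finset.mem_univ _⟩

end Expurgation

/-! ### Threshold decoding and the random codebook. -/

section Typicality

variable {X Y : Type*} [Fintype X] [Fintype Y] {n : ℕ}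

/-- The probability that the first `N` outputs are in `S` when `c` starts being sent at time `t`. -/
def outProb {N : ℕ} (Q : X → Y → ℝ) (star : X) (c : Fin n → X) (t : ℕ)
    (S : Set (Fin N → Y)) : ℝ :=
  prodProb (fun i : Fin N => Q (channelInput star c t (i + 1))) S

theorem channelInput_one {X : Type*} (star : X) (c : Fin n → X) (j : Fin n) :
    channelInput star c 1 (j + 1) = c j := by
  rw [channelInput, dif_pos ⟨by omega, by omega⟩]
  rfl

theorem outProb_one {X Y : Type*} [Fintype Y] (Q : X → Y → ℝ) (star : X) (c : Fin n → X)
    (S : Set (Fin n → Y)) :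
    outProb Q star c 1 S = prodProb (fun j => Q (c j)) S := by
  simp only [outProb, channelInput_one]

/-- The outputs for which the likelihood ratio of `c` is at least `e^γ`. -/
def typicalSet (P : X → ℝ) (Q : X → Y → ℝ) (γ : ℝ) (c : Fin n → X) : Set (Fin n → Y) :=
  {z | Real.exp γ ≤ ∏ j, Q (c j) (z j) / outputDist P Q (z j)}

theorem sum_mul_prodProb (P : X → ℝ) (Q : X → Y → ℝ) (S : Set (Fin n → Y)) :
    ∑ c : Fin n → X, (∏ j, P (c j)) * prodProb (fun j => Q (c j)) S =
      prodProb (fun _ => outputDist P Q) S := by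
  simp only [prodProb, Finset.mul_sum]
  rw [Finset.sum_comm]
  refine Finset.sum_congr rfl fun z _ => ?_
  simp only [← mul_assoc, ← Finset.sum_mul, ← Finset.prod_mul_distrib]
  rw [sum_prod_eq_prod_sum fun j x => P x * Q x (z j)]
  rfl

/-- Markov's inequality for the likelihood ratio, whose mean over a random codeword is at most one
for each fixed `z`. Since `z` is arbitrary, the bound applies to windows that contain only a piece
of the sent codeword. -/
theorem sum_mul_indicator_typicalSet_le {P : X → ℝ} (hP : P ∈ stdSimplex ℝ X) {Q : X → Y → ℝ}
    (hQ : ∀ x, Q x ∈ stdSimplex ℝ Y) (γ : ℝ) (z : Fin n → Y) :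
    ∑ c : Fin n → X, (∏ j, P (c j)) * (typicalSet P Q γ c).indicator 1 z ≤ Real.exp (-γ) := by
  have hr : ∀ x y, 0 ≤ Q x y / outputDist P Q y := fun x y =>
    div_nonneg ((hQ x).1 y) ((outputDist_mem hP hQ).1 y)
  calc ∑ c : Fin n → X, (∏ j, P (c j)) * (typicalSet P Q γ c).indicator 1 z
      ≤ ∑ c : Fin n → X, Real.exp (-γ) * ∏ j, P (c j) * (Q (c j) (z j) / outputDist P Q (z j)) := by
        refine Finset.sum_le_sum fun c _ => ?_
        have hPn : 0 ≤ ∏ j, P (c j) := Finset.prod_nonneg fun j _ => hP.1 _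
        rw [Finset.prod_mul_distrib, mul_left_comm]
        refine mul_le_mul_of_nonneg_left ?_ hPn
        by_cases hz : z ∈ typicalSet P Q γ c
        · rw [Set.indicator_of_mem hz, Pi.one_apply, Real.exp_neg, ← div_eq_inv_mul,
            le_div_iff₀ (Real.exp_pos _), one_mul]
          exact hz
        · rw [Set.indicator_of_notMem hz]
          exact mul_nonneg (Real.exp_pos _).le (Finset.prod_nonneg fun j _ => hr _ _)
    _ = Real.exp (-γ) * ∏ j, ∑ x, P x * (Q x (z j) / outputDist P Q (z j)) := by
        rw [← Finset.mul_sum, sum_prod_eq_prod_sum fun j x =>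
          P x * (Q x (z j) / outputDist P Q (z j))]
    _ ≤ Real.exp (-γ) * 1 := by
        refine mul_le_mul_of_nonneg_left ?_ (Real.exp_pos _).le
        refine Finset.prod_le_one (fun j _ => Finset.sum_nonneg fun x _ =>
          mul_nonneg (hP.1 x) (hr _ _)) fun j _ => ?_
        simp only [← mul_div_assoc, ← Finset.sum_div]
        -- The quotient is `1`, or `0` where the output probability vanishes, since `0 / 0 = 0`.
        exact div_self_le_one _
    _ = _ := mul_one _

/-- The exponential moment that controls atypical outputs of the transmitted word. -/
def tiltedMoment (P : X → ℝ) (Q : X → Y → ℝ) (r s : ℝ) : ℝ :=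
  ∑ x, ∑ y, P x * Q x y * Real.exp (s * (r - Real.log (Q x y / outputDist P Q y)))

/-- Chernoff bound: on atypical outputs the exponential weight is at least one, and its mean factors
over the letters. -/
theorem sum_mul_prodProb_compl_typicalSet_le {P : X → ℝ} (hP : P ∈ stdSimplex ℝ X) {Q : X → Y → ℝ}
    (hQ : ∀ x, Q x ∈ stdSimplex ℝ Y) (r : ℝ) {s : ℝ} (hs : 0 ≤ s) :
    ∑ c : Fin n → X, (∏ j, P (c j)) * prodProb (fun j => Q (c j)) (typicalSet P Q (n * r) c)ᶜ ≤
      tiltedMoment P Q r s ^ n := by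
  have hF : ∀ x y, 0 ≤ P x * Q x y * Real.exp (s * (r - Real.log (Q x y / outputDist P Q y))) :=
    fun x y => mul_nonneg (mul_nonneg (hP.1 x) ((hQ x).1 y)) (Real.exp_pos _).le
  have hle : ∀ (c : Fin n → X) (z : Fin n → Y),
      (∏ j, P (c j)) * ((∏ j, Q (c j) (z j)) * ((typicalSet P Q (n * r) c)ᶜ).indicator 1 z) ≤
      ∏ j, P (c j) * Q (c j) (z j) *
        Real.exp (s * (r - Real.log (Q (c j) (z j) / outputDist P Q (z j)))) := by
    intro c z
    have hR := Finset.prod_nonneg fun j (_ : j ∈ Finset.univ) => hF (c j) (z j)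
    by_cases hz : z ∈ typicalSet P Q (n * r) c
    · rw [Set.indicator_of_notMem (by simpa using hz), mul_zero, mul_zero]
      exact hR
    by_cases h0 : ∃ j, P (c j) * Q (c j) (z j) = 0
    · obtain ⟨j, hj⟩ := h0
      rw [← mul_assoc, ← Finset.prod_mul_distrib, Finset.prod_eq_zero (Finset.mem_univ j) hj,
        zero_mul]
      exact hR
    push Not at h0
    have hr : ∀ j, 0 < Q (c j) (z j) / outputDist P Q (z j) := by
      intro j
      refine div_pos (lt_of_le_of_ne ((hQ _).1 _) (Ne.symm (right_ne_zero_of_mul (h0 j))))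
        (lt_of_le_of_ne ((outputDist_mem hP hQ).1 _) fun h => h0 j ?_)
      exact mul_eq_zero_of_outputDist_eq_zero hP hQ h.symm (c j)
    rw [Set.indicator_of_mem (by simpa using hz), Pi.one_apply, mul_one,
      ← Finset.prod_mul_distrib, Finset.prod_mul_distrib (f := fun j => P (c j) * Q (c j) (z j))]
    refine le_mul_of_one_le_right (Finset.prod_nonneg fun j _ =>
      mul_nonneg (hP.1 _) ((hQ _).1 _)) ?_
    rw [← Real.exp_sum, ← Finset.mul_sum, Finset.sum_sub_distrib]
    refine Real.one_le_exp (mul_nonneg hs ?_)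
    have hlt : ∏ j, Q (c j) (z j) / outputDist P Q (z j) < Real.exp (n * r) := not_le.1 hz
    have := (Real.log_lt_log (Finset.prod_pos fun j _ => hr j) hlt).le
    rw [Real.log_exp, Real.log_prod fun j _ => (hr j).ne'] at this
    simpa using this
  calc _ ≤ ∑ c : Fin n → X, ∑ z : Fin n → Y, ∏ j, P (c j) * Q (c j) (z j) *
        Real.exp (s * (r - Real.log (Q (c j) (z j) / outputDist P Q (z j)))) := by
        simp only [prodProb, Finset.mul_sum]
        exact Finset.sum_le_sum fun c _ => Finset.sum_le_sum fun z _ => hle c z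
    _ = ∏ _j : Fin n, tiltedMoment P Q r s := by
        simp only [tiltedMoment]
        rw [← sum_prod_eq_prod_sum fun (_ : Fin n) x => ∑ y, P x * Q x y *
          Real.exp (s * (r - Real.log (Q x y / outputDist P Q y)))]
        refine Finset.sum_congr rfl fun c _ => ?_
        rw [sum_prod_eq_prod_sum fun j y => P (c j) * Q (c j) y *
          Real.exp (s * (r - Real.log (Q (c j) y / outputDist P Q y)))]
    _ = _ := by simp

theorem tiltedMoment_nonneg {P : X → ℝ} (hP : P ∈ stdSimplex ℝ X) {Q : X → Y → ℝ}
    (hQ : ∀ x, Q x ∈ stdSimplex ℝ Y) (r s : ℝ) : 0 ≤ tiltedMoment P Q r s :=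
  Finset.sum_nonneg fun x _ => Finset.sum_nonneg fun y _ =>
    mul_nonneg (mul_nonneg (hP.1 x) ((hQ x).1 y)) (Real.exp_pos _).le

-- At `s = 0` the moment equals `1` and has derivative `r - I(PQ) < 0`, so it drops below `1` for
-- small positive `s`.
open Filter Topology in
theorem exists_tiltedMoment_lt_one {P : X → ℝ} (hP : P ∈ stdSimplex ℝ X) {Q : X → Y → ℝ}
    (hQ : ∀ x, Q x ∈ stdSimplex ℝ Y) {r : ℝ} (hr : r < mutualInfo P Q) :
    ∃ s, 0 ≤ s ∧ tiltedMoment P Q r s < 1 := by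
  have hd : HasDerivAt (tiltedMoment P Q r) (r - mutualInfo P Q) 0 := by
    have h1 : HasDerivAt (tiltedMoment P Q r)
        (∑ x, ∑ y, P x * Q x y * (r - Real.log (Q x y / outputDist P Q y))) 0 := by
      unfold tiltedMoment
      refine HasDerivAt.fun_sum fun x _ => HasDerivAt.fun_sum fun y _ => ?_
      have := (((hasDerivAt_id (0 : ℝ)).mul_const
        (r - Real.log (Q x y / outputDist P Q y))).exp).const_mul (P x * Q x y)
      simpa using this
    have hone : ∑ x, ∑ y, P x * Q x y = 1 := by
      simp_rw [← Finset.mul_sum, (hQ _).2, mul_one]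
      exact hP.2
    convert h1 using 1
    simp only [mul_sub, Finset.sum_sub_distrib, ← Finset.sum_mul, hone, one_mul, mutualInfo]
    simp only [Finset.mul_sum, mul_assoc]
  have h0 : tiltedMoment P Q r 0 = 1 := by
    simp only [tiltedMoment, zero_mul, Real.exp_zero, mul_one]
    simp_rw [← Finset.mul_sum, (hQ _).2, mul_one]
    exact hP.2
  have h2 : Tendsto (slope (tiltedMoment P Q r) 0) (𝓝[>] 0) (𝓝 (r - mutualInfo P Q)) :=
    (hasDerivAt_iff_tendsto_slope.1 hd).mono_left
      (nhdsWithin_mono 0 fun s (hs : 0 < s) => hs.ne')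
  obtain ⟨s, hs1, hs2⟩ := ((h2.eventually_lt_const (sub_neg.2 hr)).and
    self_mem_nhdsWithin).exists
  refine ⟨s, le_of_lt hs2, ?_⟩
  rw [slope_def_field, sub_zero, h0, div_lt_iff₀ hs2, zero_mul] at hs1
  linarith

theorem outProb_nonneg {X Y : Type*} [Fintype Y] {N : ℕ} {Q : X → Y → ℝ}
    (hQ : ∀ x, Q x ∈ stdSimplex ℝ Y) (star : X) (c : Fin n → X) (t : ℕ) (S : Set (Fin N → Y)) :
    0 ≤ outProb Q star c t S :=
  prodProb_nonneg (fun _ => hQ _) S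

/-- Random coding: `M` codewords for which the event `Sᶜ`, atypical outputs, and confusion in any
of the `n` windows that overlap the codeword are all unlikely. -/
theorem exists_codebook {P : X → ℝ} (hP : P ∈ stdSimplex ℝ X) {Q : X → Y → ℝ}
    (hQ : ∀ x, Q x ∈ stdSimplex ℝ Y) (star : X) (hn : 0 < n) {M : ℕ} (hM : 0 < M)
    {S : Set (Fin n → Y)} {r s μ ρ : ℝ} (hs : 0 ≤ s) (hμ : 0 < μ)
    (hmiss : prodProb (fun _ => outputDist P Q) Sᶜ ≤ μ) (hρ : 0 < ρ)
    (hatyp : tiltedMoment P Q r s ≤ ρ) :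
    ∃ C : Fin M → Fin n → X, ∀ m, outProb Q star (C m) 1 Sᶜ ≤ 6 * μ ∧
      outProb Q star (C m) 1 (typicalSet P Q (n * r) (C m))ᶜ ≤ 6 * ρ ^ n ∧
      ∑ m' ∈ Finset.univ.erase m, ∑ u ∈ Finset.Icc 1 n,
        outProb Q star (C m) u (typicalSet P Q (n * r) (C m')) ≤
        12 * n * M * Real.exp (-(n * r)) := by
  have hM' : (0 : ℝ) < M := by exact_mod_cast hM
  have hn' : (0 : ℝ) < n := by exact_mod_cast hn
  have hρn : 0 < ρ ^ n := pow_pos hρ n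
  -- Each defect is divided by its own bound, so the two parts of `g` have mean at most `1` each,
  -- and `h` has mean at most `1 / (2 * M)`. Expurgation with `s = 2 + 1` leaves every normalized
  -- defect at most `6`, and `6 * β` is the last bound.
  set β : ℝ := 2 * n * M * Real.exp (-(n * r)) with hβ
  have hβ0 : 0 < β := by positivity
  let g : (Fin n → X) → ℝ := fun c => outProb Q star c 1 Sᶜ / μ +
    outProb Q star c 1 (typicalSet P Q (n * r) c)ᶜ / ρ ^ n
  let h : (Fin n → X) → (Fin n → X) → ℝ := fun c c' =>
    (∑ u ∈ Finset.Icc 1 n, outProb Q star c u (typicalSet P Q (n * r) c')) / β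
  have hg1 : ∀ c : Fin n → X, 0 ≤ outProb Q star c 1 Sᶜ / μ := fun c =>
    div_nonneg (outProb_nonneg hQ star c 1 _) hμ.le
  have hg2 : ∀ c : Fin n → X, 0 ≤ outProb Q star c 1 (typicalSet P Q (n * r) c)ᶜ / ρ ^ n :=
    fun c => div_nonneg (outProb_nonneg hQ star c 1 _) hρn.le
  have hh : ∀ c c', 0 ≤ h c c' := fun c c' =>
    div_nonneg (Finset.sum_nonneg fun u _ => outProb_nonneg hQ star c u _) hβ0.le
  have hw : (fun c : Fin n → X => ∏ j, P (c j)) ∈ stdSimplex ℝ (Fin n → X) :=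
    ⟨fun C => Finset.prod_nonneg fun i _ => hP.1 _, sum_prod_eq_one fun _ => hP⟩
  have ha : ∑ c : Fin n → X, (∏ j, P (c j)) * g c ≤ 2 := by
    simp only [g, outProb_one, mul_add, Finset.sum_add_distrib, ← mul_div_assoc, ← Finset.sum_div]
    rw [sum_mul_prodProb]
    have h1 := (div_le_one hμ).2 hmiss
    have h2 := (div_le_one hρn).2 ((sum_mul_prodProb_compl_typicalSet_le (n := n) hP hQ r hs).trans
      (pow_le_pow_left₀ (tiltedMoment_nonneg hP hQ r s) hatyp n))
    linarith
  have hb : ∑ c : Fin n → X, (∏ j, P (c j)) * ∑ c' : Fin n → X, (∏ j, P (c' j)) * h c c' ≤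
      1 / (2 * M) := by
    have h1 : ∀ c : Fin n → X, ∑ c' : Fin n → X, (∏ j, P (c' j)) * h c c' ≤ 1 / (2 * M) := by
      intro c
      simp only [h, ← mul_div_assoc, ← Finset.sum_div]
      rw [div_le_iff₀ hβ0]
      simp only [Finset.mul_sum]
      rw [Finset.sum_comm]
      have h2 : ∀ u ∈ Finset.Icc 1 n, ∑ c' : Fin n → X, (∏ j, P (c' j)) *
          outProb Q star c u (typicalSet P Q (n * r) c') ≤ Real.exp (-(n * r)) := by
        intro u _
        simp only [outProb, prodProb, Finset.mul_sum]
        rw [Finset.sum_comm]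
        -- The competitor `c'` is drawn independently of `c`, hence of the window output `z` for
        -- every offset `u`.
        have h3 : ∀ z : Fin n → Y, ∑ c' : Fin n → X, (∏ j, P (c' j)) *
            ((∏ i : Fin n, Q (channelInput star c u (i + 1)) (z i)) *
              (typicalSet P Q (n * r) c').indicator 1 z) ≤
            (∏ i : Fin n, Q (channelInput star c u (i + 1)) (z i)) * Real.exp (-(n * r)) := by
          intro z
          rw [Finset.sum_congr rfl fun c' _ => mul_left_comm _ _ _, ← Finset.mul_sum]
          exact mul_le_mul_of_nonneg_left (sum_mul_indicator_typicalSet_le hP hQ _ z)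
            (Finset.prod_nonneg fun i _ => (hQ _).1 _)
        refine (Finset.sum_le_sum fun z _ => h3 z).trans ?_
        rw [← Finset.sum_mul, sum_prod_eq_one (p := fun i : Fin n =>
          Q (channelInput star c u (i + 1))) fun _ => hQ _, one_mul]
      refine (Finset.sum_le_card_nsmul _ _ _ h2).trans (le_of_eq ?_)
      rw [nsmul_eq_mul, Nat.card_Icc, hβ]
      simp only [add_tsub_cancel_right]
      field_simp
    refine (Finset.sum_le_sum fun c _ => mul_le_mul_of_nonneg_left (h1 c) (hw.1 c)).trans ?_
    rw [← Finset.sum_mul, hw.2, one_mul]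
  obtain ⟨C, hC⟩ := exists_expurgated hw (g := g) (h := h) (fun c => add_nonneg (hg1 c) (hg2 c)) hh M
    ha hb (by positivity) (s := 3) (le_of_eq (by field_simp; norm_num)) (by norm_num)
  refine ⟨C, fun m => ?_⟩
  have h1 := hC m
  have h2 := hg1 (C m)
  have h3 := hg2 (C m)
  have h4 : 0 ≤ ∑ m' ∈ Finset.univ.erase m, h (C m) (C m') := Finset.sum_nonneg fun _ _ => hh _ _
  have hgm : g (C m) = outProb Q star (C m) 1 Sᶜ / μ +
    outProb Q star (C m) 1 (typicalSet P Q (n * r) (C m))ᶜ / ρ ^ n := rfl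
  refine ⟨(div_le_iff₀ hμ).1 (by linarith), (div_le_iff₀ hρn).1 (by linarith), ?_⟩
  have h5 : ∑ m' ∈ Finset.univ.erase m, h (C m) (C m') ≤ 6 := by linarith
  simp only [h, ← Finset.sum_div] at h5
  rw [div_le_iff₀ hβ0] at h5
  refine h5.trans (le_of_eq ?_)
  rw [hβ]
  ring

end Typicality

/-! ### Stopping rules given by a predicate on the observed string. -/

section Halting

variable {Y : Type*} {M N : ℕ}

/-- The first time at which the observed string satisfies `halt`, and at the latest `N`. -/
def haltTime (halt : List Y → Prop) (y : Fin N → Y) : ℕ :=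
  sInf {s | 1 ≤ s ∧ (s = N ∨ halt ((List.ofFn y).take s))}

theorem haltTime_mem (hN : 1 ≤ N) (halt : List Y → Prop) (y : Fin N → Y) :
    1 ≤ haltTime halt y ∧ (haltTime halt y = N ∨ halt ((List.ofFn y).take (haltTime halt y))) :=
  Nat.sInf_mem (s := {s | 1 ≤ s ∧ (s = N ∨ halt ((List.ofFn y).take s))}) ⟨N, hN, Or.inl rfl⟩

theorem haltTime_le (hN : 1 ≤ N) (halt : List Y → Prop) (y : Fin N → Y) : haltTime halt y ≤ N :=
  Nat.sInf_le ⟨hN, Or.inl rfl⟩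

theorem haltTime_le_of_halt {halt : List Y → Prop} {y : Fin N → Y} {s : ℕ} (hs : 1 ≤ s)
    (h : halt ((List.ofFn y).take s)) : haltTime halt y ≤ s :=
  Nat.sInf_le ⟨hs, Or.inr h⟩

theorem take_ofFn_eq {y y' : Fin N → Y} {s t : ℕ} (hst : s ≤ t)
    (h : ∀ i : Fin N, (i : ℕ) < t → y i = y' i) :
    (List.ofFn y).take s = (List.ofFn y').take s := by
  refine List.ext_getElem (by simp) fun i h1 h2 => ?_
  simp only [List.getElem_take, List.getElem_ofFn]
  simp only [List.length_take, List.length_ofFn] at h1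
  exact h _ (by simp only; omega)

theorem haltTime_congr (hN : 1 ≤ N) (halt : List Y → Prop) {y y' : Fin N → Y} {t : ℕ}
    (h : ∀ i : Fin N, (i : ℕ) < t → y i = y' i) (ht : haltTime halt y = t) :
    haltTime halt y' = t := by
  have h1 := haltTime_mem hN halt y
  rw [ht, take_ofFn_eq le_rfl h] at h1
  refine le_antisymm (Nat.sInf_le h1) ?_
  by_contra! hlt
  have h2 := haltTime_mem hN halt y'
  rw [← take_ofFn_eq hlt.le h] at h2
  have h3 : haltTime halt y ≤ haltTime halt y' := Nat.sInf_le h2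
  omega

/-- The sequential decoder that stops when the observed string satisfies `halt`. -/
def haltDecoder (hN : 1 ≤ N) (halt : List Y → Prop) (φ : List Y → Fin M) :
    SequentialDecoder Y M N where
  seeds := 1
  law := fun _ => 1
  law_mem := ⟨fun _ => zero_le_one, by simp⟩
  τ := fun _ y => haltTime halt y
  one_le_τ := fun _ y => (haltTime_mem hN halt y).1
  τ_le := fun _ y => haltTime_le hN halt y
  stopping := fun _ _ _ _ h ht => haltTime_congr hN halt h ht
  φ := φ

end Halting

/-! ### The sliding-window decoder on a fixed output sequence. -/

section Windows

variable {Y : Type*} {M N n : ℕ} [Inhabited Y]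

/-- The last `n` letters of a string. -/
def lastWindow (n : ℕ) (l : List Y) : Fin n → Y :=
  -- The default letter only fills strings shorter than `n`; `alarmHalt` tests no such string.
  fun j => l.getD (l.length - n + j) default

/-- Whether to stop: an alarm was raised at an earlier time `r`, and either the current window is
compatible with a message or the alarm is `n - 1` steps old. -/
def alarmHalt (S : Set (Fin n → Y)) (J : Fin M → Set (Fin n → Y)) (l : List Y) : Prop :=
  ∃ r, n ≤ r ∧ r ≤ l.length ∧ lastWindow n (l.take r) ∈ S ∧
    (r + n ≤ l.length + 1 ∨ ∃ m, lastWindow n l ∈ J m)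

open Classical in
/-- A message that is compatible with the current window. -/
def windowDecision (hM : 0 < M) (J : Fin M → Set (Fin n → Y)) (l : List Y) : Fin M :=
  if h : ∃ m, lastWindow n l ∈ J m then h.choose else ⟨0, hM⟩

/-- The window of length `n` that ends at time `s`. -/
def windowAt (n : ℕ) (y : Fin N → Y) (s : ℕ) : Fin n → Y :=
  lastWindow n ((List.ofFn y).take s)

theorem windowAt_add (y : Fin N → Y) {a : ℕ} (h : a + n ≤ N) :
    windowAt n y (a + n) = y ∘ fun j : Fin n => ⟨a + j, by omega⟩ := by
  funext j
  have hl : ((List.ofFn y).take (a + n)).length = a + n := by simp [h]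
  have hj := j.2
  rw [windowAt, lastWindow, hl, Nat.add_sub_cancel, List.getD_eq_getElem _ _ (by rw [hl]; omega)]
  simp

variable {S : Set (Fin n → Y)} {J : Fin M → Set (Fin n → Y)} {y : Fin N → Y}

theorem alarmHalt_take_iff {s : ℕ} (hs : s ≤ N) :
    alarmHalt S J ((List.ofFn y).take s) ↔ ∃ r, n ≤ r ∧ r ≤ s ∧ windowAt n y r ∈ S ∧
      (r + n ≤ s + 1 ∨ ∃ m, windowAt n y s ∈ J m) := by
  have hl : ((List.ofFn y).take s).length = s := by simp [hs]
  unfold alarmHalt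
  rw [hl]
  refine exists_congr fun r => and_congr_right fun _ => and_congr_right fun hr => ?_
  rw [List.take_take, min_eq_left hr]
  rfl

theorem windowDecision_eq (hM : 0 < M) {l : List Y} {m : Fin M} (h : ∃ m', lastWindow n l ∈ J m')
    (hu : ∀ m', lastWindow n l ∈ J m' → m' = m) : windowDecision hM J l = m := by
  rw [windowDecision, dif_pos h]
  exact hu _ h.choose_spec

/-- Correct decoding when there is no false alarm, no missed alarm, the output of the codeword is
typical, and no window that overlaps the codeword is compatible with another message. -/
theorem windowDecision_haltTime_eq (hM : 0 < M) (hn : 0 < n) {t : ℕ} (ht : 1 ≤ t)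
    (htN : t + n ≤ N + 1) (m : Fin M)
    (hF : ∀ u, n < u → u ≤ t → windowAt n y (t + n - u) ∉ S)
    (hS : windowAt n y (t + n - 1) ∈ S) (hA : windowAt n y (t + n - 1) ∈ J m)
    (hC : ∀ m', m' ≠ m → ∀ u, 1 ≤ u → u ≤ n → u ≤ t → windowAt n y (t + n - u) ∉ J m') :
    windowDecision hM J ((List.ofFn y).take (haltTime (alarmHalt S J) y)) = m := by
  set τ := haltTime (alarmHalt S J) y with hτ
  have hend : alarmHalt S J ((List.ofFn y).take (t + n - 1)) :=
    (alarmHalt_take_iff (by omega)).2 ⟨t + n - 1, by omega, le_rfl, hS, Or.inr ⟨m, hA⟩⟩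
  have hle : τ ≤ t + n - 1 := haltTime_le_of_halt (by omega) hend
  have hτN : τ ≤ N := by omega
  have hhalt : alarmHalt S J ((List.ofFn y).take τ) := by
    rcases (haltTime_mem (by omega) (alarmHalt S J) y).2 with h | h
    · rwa [show τ = t + n - 1 by omega]
    · exact h
  obtain ⟨r, hnr, hrτ, hr, hor⟩ := (alarmHalt_take_iff hτN).1 hhalt
  -- The window ending at `t + n - u` is the codeword window for `u = 1` and pure noise for `u > n`.
  -- Hence `hF` excludes every alarm before time `t`.
  have htr : t ≤ r := by
    by_contra! hlt
    refine hF (t + n - r) (by omega) (by omega) ?_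
    rwa [show t + n - (t + n - r) = r by omega]
  refine windowDecision_eq hM ?_ ?_
  · rcases hor with h | h
    -- A timeout gives `τ ≥ r + n - 1 ≥ t + n - 1`, so the decoder stops exactly at the end of the
    -- codeword.
    · rw [show τ = t + n - 1 by omega]
      exact ⟨m, hA⟩
    · exact h
  · intro m' hm'
    by_contra hne
    refine hC m' hne (t + n - τ) (by omega) (by omega) (by omega) ?_
    rw [show t + n - (t + n - τ) = τ by omega]
    exact hm'

theorem haltTime_le_of_mem (hn : 0 < n) {t : ℕ} (ht : 1 ≤ t) (htN : t + n ≤ N + 1) {m : Fin M}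
    (hS : windowAt n y (t + n - 1) ∈ S) (hA : windowAt n y (t + n - 1) ∈ J m) :
    haltTime (alarmHalt S J) y ≤ t + n :=
  (haltTime_le_of_halt (by omega) ((alarmHalt_take_iff (by omega)).2
    ⟨t + n - 1, by omega, le_rfl, hS, Or.inr ⟨m, hA⟩⟩)).trans (by omega)

/-- An alarm at the end of the codeword times out within another `n` steps. Thus failing to
recognize the message costs `O(n)` of delay, not `O(A)`, and its probability only has to vanish. -/
theorem haltTime_le_of_alarm (hn : 0 < n) {t : ℕ} (ht : 1 ≤ t) (htN : t + n ≤ N + 1)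
    (hS : windowAt n y (t + n - 1) ∈ S) :
    haltTime (alarmHalt S J) y ≤ t + 2 * n := by
  by_cases h : t + 2 * n ≤ N
  · exact haltTime_le_of_halt (by omega) ((alarmHalt_take_iff h).2
      ⟨t + n - 1, by omega, by omega, hS, Or.inl (by omega)⟩)
  · exact (haltTime_le (by omega) _ y).trans (by omega)

end Windows

/-! ### Error probability and delay of the window decoder. -/

section WindowProbabilities

variable {X Y : Type*} [Fintype Y] [Inhabited Y] {M N n : ℕ}

theorem channelInput_add (star : X) (c : Fin n → X) (t s a : ℕ) :
    channelInput star c (t + a) (s + a) = channelInput star c t s := by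
  unfold channelInput
  by_cases h : t ≤ s ∧ s < t + n
  · rw [dif_pos h, dif_pos ⟨by omega, by omega⟩]
    congr 2
    omega
  · rw [dif_neg h, dif_neg (by omega)]

/-- By shift invariance the law of a window depends only on its offset `u` from the codeword: it is
the law of the first `n` outputs when sending starts at time `u`. -/
theorem outProb_windowAt {Q : X → Y → ℝ} (hQ : ∀ x, Q x ∈ stdSimplex ℝ Y) (star : X)
    (c : Fin n → X) {t u : ℕ} (hut : u ≤ t) (h : t + n ≤ N + u) (B : Set (Fin n → Y)) :
    outProb Q star c t {y : Fin N → Y | windowAt n y (t + n - u) ∈ B} = outProb Q star c u B := by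
  obtain ⟨a, rfl⟩ := Nat.exists_eq_add_of_le hut
  have h1 : ∀ y : Fin N → Y, windowAt n y (u + a + n - u) =
      y ∘ fun j : Fin n => ⟨a + j, by omega⟩ := fun y => by
    rw [show u + a + n - u = a + n by omega]
    exact windowAt_add y (by omega)
  simp only [h1]
  rw [outProb, prodProb_preimage_comp _ (fun _ => hQ _), outProb]
  · congr 1
    funext j
    simp only
    rw [show a + (j : ℕ) + 1 = (j + 1) + a by omega, channelInput_add]
  · intro i j hij
    simp only [Fin.mk.injEq] at hij
    exact Fin.ext (by omega)

theorem outProb_of_lt {X Y : Type*} [Fintype Y] (Q : X → Y → ℝ) (star : X) (c : Fin n → X)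
    {u : ℕ} (hu : n < u)
    (B : Set (Fin n → Y)) : outProb Q star c u B = prodProb (fun _ => Q star) B := by
  unfold outProb
  congr 1
  funext j
  have := j.2
  rw [channelInput, dif_neg (by omega)]

theorem prodProb_union_le {ι B : Type*} [Fintype ι] [DecidableEq ι] [Fintype B] {p : ι → B → ℝ}
    (hp : ∀ i, p i ∈ stdSimplex ℝ B) (S T : Set (ι → B)) :
    prodProb p (S ∪ T) ≤ prodProb p S + prodProb p T := by
  simp only [prodProb, ← Finset.sum_add_distrib, ← mul_add]
  refine Finset.sum_le_sum fun y _ =>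
    mul_le_mul_of_nonneg_left ?_ (Finset.prod_nonneg fun i _ => (hp i).1 _)
  by_cases h1 : y ∈ S <;> by_cases h2 : y ∈ T <;> simp [h1, h2]

theorem prodProb_biUnion_le {ι B κ : Type*} [Fintype ι] [DecidableEq ι] [Fintype B]
    {p : ι → B → ℝ} (hp : ∀ i, p i ∈ stdSimplex ℝ B) (s : Finset κ) (T : κ → Set (ι → B)) :
    prodProb p (⋃ k ∈ s, T k) ≤ ∑ k ∈ s, prodProb p (T k) := by
  classical
  induction s using Finset.induction_on with
  | empty => simp [prodProb_empty]
  | insert k s hk ih =>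
    rw [Finset.set_biUnion_insert, Finset.sum_insert hk]
    exact (prodProb_union_le hp _ _).trans (by gcongr)

/-- Error probability of the window decoder for a given starting time. -/
theorem outProb_windowDecision_ne_le {Q : X → Y → ℝ} (hQ : ∀ x, Q x ∈ stdSimplex ℝ Y) (star : X)
    (hM : 0 < M) (hn : 0 < n) (S : Set (Fin n → Y)) (J : Fin M → Set (Fin n → Y)) (c : Fin n → X)
    (m : Fin M) {t : ℕ} (ht : 1 ≤ t) (htN : t + n ≤ N + 1) :
    outProb Q star c t {y : Fin N → Y |
        windowDecision hM J ((List.ofFn y).take (haltTime (alarmHalt S J) y)) ≠ m} ≤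
      (t - 1 : ℝ) * prodProb (fun _ => Q star) S + outProb Q star c 1 Sᶜ +
        outProb Q star c 1 (J m)ᶜ +
        ∑ m' ∈ Finset.univ.erase m, ∑ u ∈ Finset.Icc 1 n, outProb Q star c u (J m') := by
  have hp : ∀ i : Fin N, Q (channelInput star c t (i + 1)) ∈ stdSimplex ℝ Y := fun _ => hQ _
  let F : Set (Fin N → Y) := ⋃ u ∈ Finset.Icc (n + 1) t, {y | windowAt n y (t + n - u) ∈ S}
  let T : Set (Fin N → Y) := {y | windowAt n y (t + n - 1) ∈ Sᶜ}
  let V : Set (Fin N → Y) := {y | windowAt n y (t + n - 1) ∈ (J m)ᶜ}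
  let K : Set (Fin N → Y) := ⋃ m' ∈ Finset.univ.erase m, ⋃ u ∈ Finset.Icc 1 n,
    {y | u ≤ t ∧ windowAt n y (t + n - u) ∈ J m'}
  have hsub : {y : Fin N → Y |
      windowDecision hM J ((List.ofFn y).take (haltTime (alarmHalt S J) y)) ≠ m} ⊆
      F ∪ T ∪ V ∪ K := by
    intro y hy
    by_contra hnot
    simp only [Set.mem_union, not_or] at hnot
    obtain ⟨⟨⟨hF, hT⟩, hV⟩, hK⟩ := hnot
    refine hy (windowDecision_haltTime_eq hM hn ht htN m ?_ (not_not.1 hT) (not_not.1 hV) ?_)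
    · intro u hu hut hmem
      exact hF (Set.mem_biUnion (Finset.mem_coe.2 (Finset.mem_Icc.2 ⟨hu, hut⟩)) hmem)
    · intro m' hm' u h1 h2 h3 hmem
      refine hK (Set.mem_biUnion (Finset.mem_coe.2 (Finset.mem_erase.2 ⟨hm', Finset.mem_univ _⟩))
        (Set.mem_biUnion (Finset.mem_coe.2 (Finset.mem_Icc.2 ⟨h1, h2⟩)) ⟨h3, hmem⟩))
  have hFle : outProb Q star c t F ≤ (t - 1 : ℝ) * prodProb (fun _ => Q star) S := by
    refine (prodProb_biUnion_le hp _ _).trans ?_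
    have h1 : ∀ u ∈ Finset.Icc (n + 1) t,
        prodProb (fun i : Fin N => Q (channelInput star c t (i + 1)))
          {y | windowAt n y (t + n - u) ∈ S} = prodProb (fun _ => Q star) S := by
      intro u hu
      rw [Finset.mem_Icc] at hu
      rw [← outProb_of_lt Q star c (u := u) (by omega) S]
      exact outProb_windowAt hQ star c hu.2 (by omega) S
    rw [Finset.sum_congr rfl h1, Finset.sum_const, nsmul_eq_mul, Nat.card_Icc]
    refine mul_le_mul_of_nonneg_right ?_ (prodProb_nonneg (fun _ => hQ star) S)
    -- There are at most `t - 1` noise windows before the codeword. The bound vanishes at `t = 1`,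
    -- which matters when the asynchronism level is `1`.
    have h2 : t + 1 - (n + 1) ≤ t - 1 := by omega
    have h3 : ((t + 1 - (n + 1) : ℕ) : ℝ) ≤ ((t - 1 : ℕ) : ℝ) := by exact_mod_cast h2
    rwa [Nat.cast_sub ht, Nat.cast_one] at h3
  have hTle : outProb Q star c t T = outProb Q star c 1 Sᶜ :=
    outProb_windowAt hQ star c ht htN Sᶜ
  have hVle : outProb Q star c t V = outProb Q star c 1 (J m)ᶜ :=
    outProb_windowAt hQ star c ht htN (J m)ᶜ
  have hKle : outProb Q star c t K ≤
      ∑ m' ∈ Finset.univ.erase m, ∑ u ∈ Finset.Icc 1 n, outProb Q star c u (J m') := by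
    refine (prodProb_biUnion_le hp _ _).trans (Finset.sum_le_sum fun m' _ => ?_)
    refine (prodProb_biUnion_le hp _ _).trans (Finset.sum_le_sum fun u hu => ?_)
    rw [Finset.mem_Icc] at hu
    by_cases hut : u ≤ t
    · simp only [hut, true_and]
      exact (outProb_windowAt hQ star c hut (by omega) (J m')).le
    · simp only [hut, false_and]
      exact (prodProb_empty _).le.trans (outProb_nonneg hQ star c u _)
  have h1 : outProb Q star c t _ ≤ outProb Q star c t (F ∪ T ∪ V ∪ K) := prodProb_mono hp hsub
  have h2 : outProb Q star c t (F ∪ T ∪ V ∪ K) ≤ outProb Q star c t (F ∪ T ∪ V) +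
    outProb Q star c t K := prodProb_union_le hp _ _
  have h3 : outProb Q star c t (F ∪ T ∪ V) ≤ outProb Q star c t (F ∪ T) + outProb Q star c t V :=
    prodProb_union_le hp _ _
  have h4 : outProb Q star c t (F ∪ T) ≤ outProb Q star c t F + outProb Q star c t T :=
    prodProb_union_le hp _ _
  linarith

/-- Expected delay of the window decoder for a given starting time. -/
theorem sum_outputProb_mul_delay_le {Q : X → Y → ℝ} (hQ : ∀ x, Q x ∈ stdSimplex ℝ Y) (star : X)
    (hn : 0 < n) (S : Set (Fin n → Y)) (J : Fin M → Set (Fin n → Y)) (c : Fin n → X)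
    (m : Fin M) {t A : ℕ} (ht : 1 ≤ t) (htA : t ≤ A) :
    ∑ y : Fin (A + n - 1) → Y, outputProb Q star c t y *
        max ((haltTime (alarmHalt S J) y : ℝ) - t) 0 ≤
      n + n * outProb Q star c 1 (J m)ᶜ + A * outProb Q star c 1 Sᶜ := by
  have htN : t + n ≤ (A + n - 1) + 1 := by omega
  have hp : ∀ i : Fin (A + n - 1), Q (channelInput star c t (i + 1)) ∈ stdSimplex ℝ Y :=
    fun _ => hQ _
  let T : Set (Fin (A + n - 1) → Y) := {y | windowAt n y (t + n - 1) ∈ Sᶜ}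
  let V : Set (Fin (A + n - 1) → Y) := {y | windowAt n y (t + n - 1) ∈ (J m)ᶜ}
  have hTle : outProb Q star c t T = outProb Q star c 1 Sᶜ :=
    outProb_windowAt hQ star c ht htN Sᶜ
  have hVle : outProb Q star c t V = outProb Q star c 1 (J m)ᶜ :=
    outProb_windowAt hQ star c ht htN (J m)ᶜ
  -- The delay is at most `n` if the alarm and the message are both recognized at the end of the
  -- codeword, `2 * n` if only the alarm is, and `n + A` in any case.
  have hpt : ∀ y : Fin (A + n - 1) → Y, max ((haltTime (alarmHalt S J) y : ℝ) - t) 0 ≤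
      n + n * V.indicator 1 y + A * T.indicator 1 y := by
    intro y
    have hV0 : (0 : ℝ) ≤ V.indicator 1 y := Set.indicator_nonneg (fun _ _ => zero_le_one) _
    have hT0 : (0 : ℝ) ≤ T.indicator 1 y := Set.indicator_nonneg (fun _ _ => zero_le_one) _
    refine max_le ?_ (by positivity)
    by_cases hT : y ∈ T
    · have h1 : haltTime (alarmHalt S J) y ≤ n + A + t :=
        (haltTime_le (by omega) _ y).trans (by omega)
      have h2 : (haltTime (alarmHalt S J) y : ℝ) ≤ n + A + t := by exact_mod_cast h1
      rw [Set.indicator_of_mem hT, Pi.one_apply]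
      nlinarith [mul_nonneg (Nat.cast_nonneg (α := ℝ) n) hV0]
    · have hS : windowAt n y (t + n - 1) ∈ S := not_not.1 hT
      by_cases hV : y ∈ V
      · have h1 := haltTime_le_of_alarm (J := J) hn ht htN hS
        have h2 : (haltTime (alarmHalt S J) y : ℝ) ≤ t + 2 * n := by exact_mod_cast h1
        rw [Set.indicator_of_notMem hT, Set.indicator_of_mem hV, Pi.one_apply]
        linarith
      · have h1 := haltTime_le_of_mem hn ht htN hS (not_not.1 hV)
        have h2 : (haltTime (alarmHalt S J) y : ℝ) ≤ t + n := by exact_mod_cast h1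
        rw [Set.indicator_of_notMem hT, Set.indicator_of_notMem hV]
        linarith
  refine (Finset.sum_le_sum fun y _ => mul_le_mul_of_nonneg_left (hpt y)
    (Finset.prod_nonneg fun i _ => (hp i).1 _)).trans (le_of_eq ?_)
  rw [← hTle, ← hVle]
  simp only [mul_add, Finset.sum_add_distrib]
  congr 1
  · congr 1
    · rw [← Finset.sum_mul]
      have : ∑ y : Fin (A + n - 1) → Y, outputProb Q star c t y = 1 := sum_prod_eq_one hp
      exact (congrArg (· * (n : ℝ)) this).trans (one_mul _)
    · rw [outProb, prodProb, Finset.mul_sum]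
      exact Finset.sum_congr rfl fun y _ => mul_left_comm _ _ _
  · rw [outProb, prodProb, Finset.mul_sum]
    exact Finset.sum_congr rfl fun y _ => mul_left_comm _ _ _

/-- The code with codewords `C` whose decoder raises an alarm when the last `n` outputs are in `S`,
and then looks for a message `m` for which they are in `J m`. -/
def windowCode {n : ℕ+} (hM : 2 ≤ M) (C : Fin M → Fin n → X) (S : Set (Fin n → Y))
    (J : Fin M → Set (Fin n → Y)) : Code X Y n where
  M := M
  two_le := hM
  codeword := C
  decoder := fun A => haltDecoder (by have := A.pos; have := n.pos; omega) (alarmHalt S J)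
    (windowDecision (by omega) J)

theorem windowCode_errorProb_le {n : ℕ+} {Q : X → Y → ℝ} (hQ : ∀ x, Q x ∈ stdSimplex ℝ Y) (star : X)
    (hM : 2 ≤ M) (C : Fin M → Fin n → X) (S : Set (Fin n → Y)) (J : Fin M → Set (Fin n → Y))
    (A : ℕ+) {e : ℝ}
    (he : ∀ m, ((A : ℕ) - 1 : ℝ) * prodProb (fun _ => Q star) S + outProb Q star (C m) 1 Sᶜ +
        outProb Q star (C m) 1 (J m)ᶜ +
        ∑ m' ∈ Finset.univ.erase m, ∑ u ∈ Finset.Icc 1 (n : ℕ), outProb Q star (C m) u (J m') ≤ e) :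
    (windowCode hM C S J).errorProb Q star A ≤ e := by
  have hA : (0 : ℝ) < (A : ℕ) := by exact_mod_cast A.pos
  have : Nonempty (Fin (windowCode hM C S J).M) := ⟨⟨0, by simp only [windowCode]; omega⟩⟩
  refine ciSup_le fun m => ?_
  rw [div_le_iff₀ hA]
  refine (Finset.sum_le_card_nsmul _ _ e fun t ht => ?_).trans (le_of_eq ?_)
  · rw [Finset.mem_Icc] at ht
    refine le_trans (le_trans (le_of_eq ?_) (outProb_windowDecision_ne_le (N := A + n - 1) hQ star
      (by omega : 0 < M) n.pos S J (C m) m ht.1 (by omega))) (le_trans ?_ (he m))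
    · rw [Code.expect, outProb, prodProb]
      change ∑ w : Fin 1, (1 : ℝ) * _ = _
      rw [Fin.sum_univ_one, one_mul]
      refine Finset.sum_congr rfl fun y _ => ?_
      congr 1
      classical
      rw [Set.indicator_apply]
      exact if_congr Iff.rfl rfl rfl
    · have h1 : (t : ℝ) ≤ (A : ℕ) := by exact_mod_cast ht.2
      have h2 := mul_le_mul_of_nonneg_right (sub_le_sub_right h1 1)
        (prodProb_nonneg (fun _ : Fin n => hQ star) S)
      linarith
  · rw [nsmul_eq_mul, Nat.card_Icc, Nat.add_sub_cancel, mul_comm]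

theorem windowCode_delay_le {n : ℕ+} {Q : X → Y → ℝ} (hQ : ∀ x, Q x ∈ stdSimplex ℝ Y) (star : X)
    (hM : 2 ≤ M) (C : Fin M → Fin n → X) (S : Set (Fin n → Y)) (J : Fin M → Set (Fin n → Y))
    (A : ℕ+) {d : ℝ}
    (hd : ∀ m, (n : ℕ) + (n : ℕ) * outProb Q star (C m) 1 (J m)ᶜ +
      (A : ℕ) * outProb Q star (C m) 1 Sᶜ ≤ d) :
    (windowCode hM C S J).delay Q star A ≤ d := by
  have hA : (0 : ℝ) < (A : ℕ) := by exact_mod_cast A.pos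
  have : Nonempty (Fin (windowCode hM C S J).M) := ⟨⟨0, by simp only [windowCode]; omega⟩⟩
  refine ciSup_le fun m => ?_
  rw [div_le_iff₀ hA]
  refine (Finset.sum_le_card_nsmul _ _ d fun t ht => ?_).trans (le_of_eq ?_)
  · rw [Finset.mem_Icc] at ht
    refine le_trans (le_trans (le_of_eq ?_) (sum_outputProb_mul_delay_le hQ star n.pos S J (C m) m
      ht.1 ht.2)) (hd m)
    rw [Code.expect]
    change ∑ w : Fin 1, (1 : ℝ) * _ = _
    rw [Fin.sum_univ_one, one_mul]
    rfl
  · rw [nsmul_eq_mul, Nat.card_Icc, Nat.add_sub_cancel, mul_comm]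

end WindowProbabilities

/-! ### Choice of parameters for large blocklength, and the diagonal argument. -/

section Asymptotics

open Filter Topology

theorem tendsto_succ_pow_mul_exp_neg (k : ℕ) {b : ℝ} (hb : 0 < b) :
    Tendsto (fun n : ℕ => ((n : ℝ) + 1) ^ k * Real.exp (-(n * b))) atTop (𝓝 0) := by
  have hr : |Real.exp (-b)| < 1 := by
    rw [abs_of_pos (Real.exp_pos _)]
    exact Real.exp_lt_one_iff.2 (by linarith)
  have h := ((tendsto_pow_const_mul_const_pow_of_abs_lt_one k hr).comp
    (tendsto_add_atTop_nat 1)).mul_const (Real.exp b)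
  rw [zero_mul] at h
  refine h.congr fun n => ?_
  simp only [Function.comp_apply, Nat.cast_add, Nat.cast_one]
  rw [mul_assoc, ← Real.exp_nat_mul, ← Real.exp_add]
  congr 2
  push_cast
  ring

theorem asyncLevel_cast_lt (a : ℝ) (n : ℕ+) :
    ((asyncLevel a n : ℕ) : ℝ) < Real.exp (a * (n : ℕ)) + 1 :=
  Nat.ceil_lt_add_one (Real.exp_pos _).le

theorem asyncLevel_of_neg {a : ℝ} (ha : a < 0) (n : ℕ+) : asyncLevel a n = 1 := by
  have hn : (0 : ℝ) < (n : ℕ) := by exact_mod_cast n.pos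
  have h : Real.exp (a * (n : ℕ)) < 1 := Real.exp_lt_one_iff.2 (mul_neg_of_neg_of_pos ha hn)
  have h1 : ⌈Real.exp (a * (n : ℕ))⌉₊ ≤ 1 := Nat.ceil_le.2 (by simpa using h.le)
  exact le_antisymm h1 one_le

theorem asyncLevel_mono {a b : ℝ} (h : a ≤ b) (n : ℕ+) : asyncLevel a n ≤ asyncLevel b n := by
  refine Nat.ceil_mono (Real.exp_le_exp.2 ?_)
  exact mul_le_mul_of_nonneg_right h (Nat.cast_nonneg _)

/-- A set of output words that detects the presence of a codeword reliably enough for the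
asynchronism exponent `a - δ`. -/
theorem eventually_exists_alarmSet {X Y : Type*} [Fintype X] [Fintype Y] {Q : X → Y → ℝ}
    (hQ : ∀ x, Q x ∈ stdSimplex ℝ Y) (star : X) {P : X → ℝ} (hP : P ∈ stdSimplex ℝ X) {a : ℝ}
    (ha : ∀ V ∈ stdSimplex ℝ Y, (a : EReal) ≤ divergence V (outputDist P Q) ∨
      (a : EReal) ≤ divergence V (Q star)) {δ κ : ℝ} (hδ : 0 < δ) (hκ : 0 < κ) :
    ∀ᶠ k : ℕ in atTop, ∀ n : ℕ+, (n : ℕ) = k → ∃ (S : Set (Fin n → Y)) (μ : ℝ), 0 < μ ∧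
      prodProb (fun _ => outputDist P Q) Sᶜ ≤ μ ∧ ∀ A : ℕ+, A ≤ asyncLevel (a - δ) n →
        ((A : ℕ) - 1 : ℝ) * prodProb (fun _ => Q star) S ≤ κ ∧ (A : ℕ) * μ ≤ κ := by
  have hout := outputDist_mem hP hQ
  rcases le_or_gt a 0 with ha0 | ha0
  · have h := (tendsto_succ_pow_mul_exp_neg 0 one_pos).eventually_le_const hκ
    filter_upwards [h] with k hk n hn
    -- Here `a - δ < 0`, so the level is `1`: always raising the alarm never misses, and the factor
    -- `A - 1` of the false-alarm term is zero.
    refine ⟨Set.univ, Real.exp (-(k * 1)), Real.exp_pos _, ?_, fun A hA => ?_⟩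
    · rw [Set.compl_univ, prodProb_empty]
      exact (Real.exp_pos _).le
    · rw [asyncLevel_of_neg (by linarith)] at hA
      obtain rfl : A = 1 := le_antisymm hA one_le
      simp only [PNat.one_coe, Nat.cast_one, sub_self, zero_mul, one_mul]
      rw [pow_zero, one_mul] at hk
      exact ⟨hκ.le, hk⟩
  · have h1 := (tendsto_succ_pow_mul_exp_neg (Fintype.card Y) hδ).eventually_le_const (half_pos hκ)
    have h2 := (tendsto_succ_pow_mul_exp_neg (Fintype.card Y) ha0).eventually_le_const (half_pos hκ)
    filter_upwards [h1, h2] with k hk1 hk2 n hn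
    subst hn
    let S : Set (Fin n → Y) := {z | (a : EReal) ≤ divergence (wordType z) (Q star)}
    have hS : prodProb (fun _ => Q star) S ≤
        (((n : ℕ) : ℝ) + 1) ^ Fintype.card Y * Real.exp (-((n : ℕ) * a)) :=
      prodProb_le_of_forall_le_divergence n.pos (hQ star) fun z hz => hz
    have hSc : prodProb (fun _ => outputDist P Q) Sᶜ ≤
        (((n : ℕ) : ℝ) + 1) ^ Fintype.card Y * Real.exp (-((n : ℕ) * a)) :=
      prodProb_le_of_forall_le_divergence n.pos hout fun z hz =>
        (ha _ (wordType_mem n.pos z)).resolve_right hz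
    refine ⟨S, _, by positivity, hSc, fun A hA => ?_⟩
    have hAle : ((A : ℕ) : ℝ) - 1 ≤ Real.exp ((a - δ) * (n : ℕ)) := by
      have h3 : ((A : ℕ) : ℝ) ≤ (asyncLevel (a - δ) n : ℕ) := by exact_mod_cast hA
      linarith [asyncLevel_cast_lt (a - δ) n]
    have hA1 : (0 : ℝ) ≤ ((A : ℕ) : ℝ) - 1 := by
      have : (1 : ℝ) ≤ (A : ℕ) := by exact_mod_cast A.pos
      linarith
    have hmul : (((A : ℕ) : ℝ) - 1) * ((((n : ℕ) : ℝ) + 1) ^ Fintype.card Y *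
        Real.exp (-((n : ℕ) * a))) ≤ κ / 2 := by
      refine le_trans ?_ hk1
      rw [mul_left_comm]
      refine mul_le_mul_of_nonneg_left ?_ (by positivity)
      refine (mul_le_mul_of_nonneg_right hAle (Real.exp_pos _).le).trans (le_of_eq ?_)
      rw [← Real.exp_add]
      congr 1
      ring
    constructor
    · exact (mul_le_mul_of_nonneg_left hS hA1).trans (hmul.trans (half_le_self hκ.le))
    -- Here `A * μ = (A - 1) * μ + μ`, and each summand is at most `κ / 2`.
    · linarith

/-- Good codes of all large blocklengths, for a fixed margin `δ`. -/
theorem eventually_exists_code {X Y : Type*} [Fintype X] [Fintype Y] {Q : X → Y → ℝ}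
    (hQ : ∀ x, Q x ∈ stdSimplex ℝ Y) (star : X) {P : X → ℝ} (hP : P ∈ stdSimplex ℝ X)
    (hI : 0 < mutualInfo P Q) {a : ℝ}
    (ha : ∀ V ∈ stdSimplex ℝ Y, (a : EReal) ≤ divergence V (outputDist P Q) ∨
      (a : EReal) ≤ divergence V (Q star)) {δ : ℝ} (hδ : 0 < δ) :
    ∀ᶠ k : ℕ in atTop, ∀ n : ℕ+, (n : ℕ) = k → ∃ c : Code X Y n,
      (n : ℕ) * (mutualInfo P Q - δ) ≤ Real.log c.M ∧
      ∀ A : ℕ+, A ≤ asyncLevel (a - δ) n →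
        c.errorProb Q star A ≤ δ ∧ c.delay Q star A ≤ (n : ℕ) * (1 + δ) := by
  have : Nonempty Y := by
    by_contra h
    rw [not_nonempty_iff] at h
    simpa using (hQ star).2
  have : Inhabited Y := Classical.inhabited_of_nonempty this
  set I := mutualInfo P Q
  -- The code rate `I - 2η` lies below the decoding threshold `I - η`, which lies below `I`. The
  -- first gap defeats confusion, the second makes the true codeword typical; `2η < I` gives `M ≥
  -- 2`.
  obtain ⟨η, hη0, hηδ, hηI⟩ : ∃ η : ℝ, 0 < η ∧ 2 * η ≤ δ ∧ 2 * η < I :=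
    ⟨min (δ / 2) (I / 4), lt_min (by linarith) (by linarith),
      by linarith [min_le_left (δ / 2) (I / 4)], by linarith [min_le_right (δ / 2) (I / 4)]⟩
  obtain ⟨s, hs0, hs1⟩ := exists_tiltedMoment_lt_one hP hQ (r := I - η) (by linarith)
  obtain ⟨ρ, hρ0, hρ1, hsρ⟩ : ∃ ρ : ℝ, 0 < ρ ∧ ρ < 1 ∧ tiltedMoment P Q (I - η) s ≤ ρ :=
    ⟨max (tiltedMoment P Q (I - η) s) (1 / 2), lt_max_of_lt_right (by norm_num),
      max_lt hs1 (by norm_num), le_max_left _ _⟩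
  -- Error budget: `δ / 24` for false alarms, `6 * δ / 24` each for a miss and for atypical output,
  -- `24 * δ / 96` for confusion. The delay exceeds `n` by at most `n * δ / 4 + δ / 4`.
  have hδ24 : 0 < δ / 24 := by linarith
  have hρlim := (tendsto_pow_atTop_nhds_zero_of_lt_one hρ0.le hρ1).eventually_le_const hδ24
  have hηlim := (tendsto_succ_pow_mul_exp_neg 1 hη0).eventually_le_const
    (show 0 < δ / 96 by linarith)
  filter_upwards [eventually_exists_alarmSet hQ star hP ha hδ hδ24, hρlim, hηlim]
    with k hk hρk hηk n hn
  obtain ⟨S, μ, hμ, hmiss, hA⟩ := hk n hn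
  subst hn
  have hn0 : (0 : ℝ) < (n : ℕ) := by exact_mod_cast n.pos
  have hn1 : (1 : ℝ) ≤ (n : ℕ) := by exact_mod_cast n.pos
  set M := ⌈Real.exp ((n : ℕ) * (I - 2 * η))⌉₊ with hMdef
  have hexp1 : 1 < Real.exp ((n : ℕ) * (I - 2 * η)) :=
    Real.one_lt_exp_iff.2 (mul_pos hn0 (by linarith))
  have hM2 : 2 ≤ M := Nat.lt_ceil.2 (by simpa using hexp1)
  have hMle : (M : ℝ) ≤ 2 * Real.exp ((n : ℕ) * (I - 2 * η)) := by
    have := Nat.ceil_lt_add_one (Real.exp_pos ((n : ℕ) * (I - 2 * η))).le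
    linarith
  obtain ⟨C, hC⟩ := exists_codebook hP hQ star n.pos (M := M) (by omega) hs0 hμ hmiss hρ0 hsρ
  have hconf : 12 * ((n : ℕ) : ℝ) * M * Real.exp (-((n : ℕ) * (I - η))) ≤ δ / 4 := by
    have h1 : 12 * ((n : ℕ) : ℝ) * M * Real.exp (-((n : ℕ) * (I - η))) ≤
        12 * ((n : ℕ) : ℝ) * (2 * Real.exp ((n : ℕ) * (I - 2 * η))) *
          Real.exp (-((n : ℕ) * (I - η))) := by gcongr
    have h2 : 12 * ((n : ℕ) : ℝ) * (2 * Real.exp ((n : ℕ) * (I - 2 * η))) *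
          Real.exp (-((n : ℕ) * (I - η))) = 24 * ((n : ℕ) * Real.exp (-((n : ℕ) * η))) := by
      have h3 : Real.exp (-((n : ℕ) * η)) = Real.exp ((n : ℕ) * (I - 2 * η)) *
          Real.exp (-((n : ℕ) * (I - η))) := by
        rw [← Real.exp_add]
        congr 1
        ring
      rw [h3]
      ring
    have h4 : ((n : ℕ) : ℝ) * Real.exp (-((n : ℕ) * η)) ≤
        (((n : ℕ) : ℝ) + 1) ^ 1 * Real.exp (-((n : ℕ) * η)) := by
      rw [pow_one]
      gcongr
      linarith
    linarith
  refine ⟨windowCode hM2 C S fun m => typicalSet P Q ((n : ℕ) * (I - η)) (C m), ?_, fun A hAle => ?_⟩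
  · refine le_trans (mul_le_mul_of_nonneg_left (by linarith : I - δ ≤ I - 2 * η) hn0.le) ?_
    rw [← Real.log_exp ((n : ℕ) * (I - 2 * η))]
    exact Real.log_le_log (Real.exp_pos _) (Nat.le_ceil _)
  · obtain ⟨hA1, hA2⟩ := hA A hAle
    have hμA : μ ≤ δ / 24 := by
      refine le_trans (le_mul_of_one_le_left hμ.le ?_) hA2
      exact_mod_cast A.pos
    constructor
    · refine windowCode_errorProb_le hQ star hM2 C S _ A fun m => ?_
      obtain ⟨h1, h2, h3⟩ := hC m
      linarith
    · refine windowCode_delay_le hQ star hM2 C S _ A fun m => ?_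
      obtain ⟨h1, h2, h3⟩ := hC m
      have h4 := mul_le_mul_of_nonneg_left h1 (Nat.cast_nonneg (α := ℝ) (A : ℕ))
      have h5 := mul_le_mul_of_nonneg_left (h2.trans
        (mul_le_mul_of_nonneg_left hρk (by norm_num : (0 : ℝ) ≤ 6))) hn0.le
      have h6 : δ ≤ (n : ℕ) * δ := le_mul_of_one_le_left hδ.le hn1
      linarith

/-- For each `n` take the smallest margin `1 / (k + 1)` with `k ≤ n` for which a good choice exists.
Every fixed `k` is eventually available, so the chosen margin eventually falls below any `δ`, and
monotonicity does the rest. -/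
theorem exists_diagonal {T : ℕ+ → Type*} [∀ n, Nonempty (T n)] {G : ℝ → ∀ n, T n → Prop}
    (hmono : ∀ δ δ' n c, δ ≤ δ' → G δ n c → G δ' n c)
    (h : ∀ δ : ℝ, 0 < δ → ∀ᶠ k : ℕ in atTop, ∀ n : ℕ+, (n : ℕ) = k → ∃ c, G δ n c) :
    ∃ c : ∀ n, T n, ∀ δ : ℝ, 0 < δ → ∃ n₀ : ℕ+, ∀ n, n₀ ≤ n → G δ n (c n) := by
  classical
  let p : ℕ+ → ℕ → Prop := fun n k => ∃ c, G (1 / ((k : ℝ) + 1)) n c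
  let g : ℕ+ → ℕ := fun n => Nat.findGreatest (p n) n
  refine ⟨fun n => if hn : p n (g n) then hn.choose else Classical.arbitrary _, fun δ hδ => ?_⟩
  obtain ⟨k, hk⟩ := exists_nat_one_div_lt hδ
  obtain ⟨n₀, hn₀⟩ := eventually_atTop.1 (h _ (Nat.one_div_pos_of_nat (α := ℝ) (n := k)))
  refine ⟨⟨n₀ + k + 1, by omega⟩, fun n hn => ?_⟩
  have hn' : n₀ + k + 1 ≤ (n : ℕ) := hn
  have hpk : p n k := hn₀ n (by omega) n rfl
  have hp : p n (g n) := Nat.findGreatest_spec (by omega : k ≤ (n : ℕ)) hpk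
  have hkg : k ≤ g n := Nat.le_findGreatest (by omega) hpk
  simp only [hp, dif_pos]
  refine hmono _ _ _ _ (le_trans ?_ hk.le) hp.choose_spec
  exact one_div_le_one_div_of_le (by positivity) (by gcongr)

end Asymptotics

/-! ### From good codes to achievability and the capacity bound. -/

section Achievability

variable {X Y : Type*} [Fintype X] [Fintype Y] {Q : X → Y → ℝ}

/-- The condition on `δ` gives `(R - ε) * (1 + δ) ≤ R - δ`. Positivity of `ln M` covers a vanishing
delay, where the rate is infinite. -/
theorem le_rate_of_delay_le {X Y : Type*} [Fintype Y] {Q : X → Y → ℝ} {n : ℕ+}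
    (c : Code X Y n) (star : X) (A : ℕ+)
    {R δ ε : ℝ} (hδ0 : 0 < δ) (hε : 0 < ε) (hδ : δ * (R + 1) ≤ ε)
    (hM : (n : ℕ) * (R - δ) ≤ Real.log c.M) (hd : c.delay Q star A ≤ (n : ℕ) * (1 + δ)) :
    ENNReal.ofReal (R - ε) ≤ c.rate Q star A := by
  rcases le_or_gt (R - ε) 0 with h | h
  · rw [ENNReal.ofReal_of_nonpos h]
    exact zero_le
  have hlog : 0 < Real.log c.M := Real.log_pos (by exact_mod_cast c.two_le)
  rw [Code.rate, ENNReal.le_div_iff_mul_le (Or.inr (ENNReal.ofReal_pos.2 hlog).ne')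
    (Or.inl ENNReal.ofReal_ne_top), ← ENNReal.ofReal_mul h.le]
  refine ENNReal.ofReal_le_ofReal (le_trans ?_ hM)
  refine (mul_le_mul_of_nonneg_left hd h.le).trans ?_
  rw [mul_left_comm]
  refine mul_le_mul_of_nonneg_left ?_ (Nat.cast_nonneg _)
  nlinarith [mul_pos hδ0 hε]

theorem achievable_mutualInfo (hQ : ∀ x, Q x ∈ stdSimplex ℝ Y) (star : X)
    (hC : 0 < syncCapacity Q) {α : ℝ} (hα : 0 ≤ α) {P : X → ℝ} (hP : P ∈ stdSimplex ℝ X)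
    (h : ∀ V ∈ stdSimplex ℝ Y, (α : EReal) ≤ divergence V (outputDist P Q) ∨
      (α : EReal) ≤ divergence V (Q star)) :
    Achievable Q star (mutualInfo P Q) α := by
  have hR := mutualInfo_nonneg hP hQ
  refine ⟨hR, hα, ?_⟩
  set R := mutualInfo P Q
  have hne : Nonempty Y := by
    by_contra hemp
    rw [not_nonempty_iff] at hemp
    simpa using (hQ star).2
  have : Inhabited Y := Classical.inhabited_of_nonempty hne
  have : ∀ n : ℕ+, Nonempty (Code X Y n) := fun n =>
    ⟨windowCode (M := 2) le_rfl (fun _ _ => star) ∅ fun _ => ∅⟩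
  -- Demanding the bounds at all levels up to `asyncLevel (α - δ) n` makes `G` monotone in `δ`, as
  -- the diagonal argument requires.
  let G : ℝ → ∀ n : ℕ+, Code X Y n → Prop := fun δ n c =>
    (n : ℕ) * (R - δ) ≤ Real.log c.M ∧ ∀ A : ℕ+, A ≤ asyncLevel (α - δ) n →
      c.errorProb Q star A ≤ δ ∧ c.delay Q star A ≤ (n : ℕ) * (1 + δ)
  have hmono : ∀ δ δ' n c, δ ≤ δ' → G δ n c → G δ' n c := by
    rintro δ δ' n c hδ ⟨h1, h2⟩
    have hn0 : (0 : ℝ) ≤ (n : ℕ) := Nat.cast_nonneg _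
    refine ⟨le_trans (mul_le_mul_of_nonneg_left (by linarith) hn0) h1, fun A hA => ?_⟩
    obtain ⟨h3, h4⟩ := h2 A (hA.trans (asyncLevel_mono (by linarith) n))
    exact ⟨h3.trans hδ, h4.trans (mul_le_mul_of_nonneg_left (by linarith) hn0)⟩
  have hex : ∀ δ : ℝ, 0 < δ → ∀ᶠ k : ℕ in Filter.atTop, ∀ n : ℕ+, (n : ℕ) = k → ∃ c, G δ n c := by
    intro δ hδ
    -- Half of the margin pays for the perturbation of `P`, the other half for the code.
    obtain ⟨P', hP', hI, hIR, hV⟩ := exists_mutualInfo_pos hQ star hC hP h (half_pos hδ)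
    filter_upwards [eventually_exists_code hQ star hP' hI hV (half_pos hδ)] with k hk n hn
    obtain ⟨c, h1, h2⟩ := hk n hn
    have hn0 : (0 : ℝ) ≤ (n : ℕ) := Nat.cast_nonneg _
    refine ⟨c, le_trans (mul_le_mul_of_nonneg_left (by linarith) hn0) h1, fun A hA => ?_⟩
    obtain ⟨h3, h4⟩ := h2 A (by rwa [sub_sub, add_halves])
    exact ⟨by linarith, h4.trans (mul_le_mul_of_nonneg_left (by linarith) hn0)⟩
  obtain ⟨c, hc⟩ := exists_diagonal hmono hex
  refine ⟨c, fun ε hε => ?_⟩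
  have hR1 : 0 < R + 1 := by linarith
  have hδ : 0 < ε / (R + 1) := div_pos hε hR1
  obtain ⟨n₀, hn₀⟩ := hc _ hδ
  refine ⟨n₀, fun n hn => ?_⟩
  obtain ⟨h1, h2⟩ := hn₀ n hn
  have hle : ε / (R + 1) ≤ ε := div_le_self hε.le (by linarith)
  obtain ⟨h3, h4⟩ := h2 (asyncLevel (α - ε) n) (asyncLevel_mono (by linarith) n)
  exact ⟨le_rate_of_delay_le _ star _ hδ hε (div_mul_cancel₀ _ hR1.ne').le h1 h4,
    h3.trans hle⟩

theorem Achievable.mono {X Y : Type*} [Fintype Y] {Q : X → Y → ℝ} {star : X} {R R' α : ℝ}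
    (hR : 0 ≤ R) (hRR' : R ≤ R')
    (h : Achievable Q star R' α) : Achievable Q star R α := by
  obtain ⟨_, hα, c, hc⟩ := h
  refine ⟨hR, hα, c, fun ε hε => ?_⟩
  obtain ⟨n₀, hn₀⟩ := hc ε hε
  refine ⟨n₀, fun n hn => ⟨le_trans (ENNReal.ofReal_le_ofReal (by linarith)) (hn₀ n hn).1,
    (hn₀ n hn).2⟩⟩

theorem alphaMinus_le_asyncCapacity (hQ : ∀ x, Q x ∈ stdSimplex ℝ Y) (star : X)
    (hC : 0 < syncCapacity Q) {R : ℝ} (hR : 0 < R) :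
    alphaMinus Q star R ≤ asyncCapacity Q star R := by
  refine iSup₂_le fun P hP => ?_
  have hreal : ∀ α : ℝ, 0 ≤ α → (α : EReal) ≤ noiseExponent Q star P →
      (α : EReal) ≤ asyncCapacity Q star R := by
    intro α hα hle
    refine le_sSup ⟨α, Achievable.mono hR.le hP.2
      (achievable_mutualInfo hQ star hC hα hP.1 fun V hV => ?_), rfl⟩
    exact le_max_iff.1 (hle.trans (iInf₂_le V hV))
  have h0 := noiseExponent_nonneg hQ star P
  induction hx : noiseExponent Q star P with
  | bot => exact bot_le
  | coe x =>
    rw [hx] at h0 hreal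
    exact hreal x (EReal.coe_nonneg.1 h0) le_rfl
  | top =>
    rw [hx] at hreal
    rw [top_le_iff, EReal.eq_top_iff_forall_lt]
    intro y
    -- With an infinite noise exponent every nonnegative real exponent is achievable; one larger
    -- than `y` is used.
    refine lt_of_lt_of_le ?_ (hreal (max y 0 + 1) (by positivity) le_top)
    exact EReal.coe_lt_coe_iff.2 (by linarith [le_max_left y 0])

end Achievability

end AsyncComm

end

theorem theorem1 {X Y : Type*} [Fintype X] [Fintype Y] (Q : X → Y → ℝ)
    (hQ : ∀ x, Q x ∈ stdSimplex ℝ Y) (star : X) (hC : 0 < AsyncComm.syncCapacity Q) :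
    (∀ α : ℝ, 0 ≤ α → ∀ P ∈ stdSimplex ℝ X,
      (∀ V ∈ stdSimplex ℝ Y,
        (α : EReal) ≤ AsyncComm.divergence V (AsyncComm.outputDist P Q) ∨
        (α : EReal) ≤ AsyncComm.divergence V (Q star)) →
      AsyncComm.Achievable Q star (AsyncComm.mutualInfo P Q) α) ∧
    (∀ P ∈ stdSimplex ℝ X,
      IsLeast (AsyncComm.maxDivergence Q star P '' stdSimplex ℝ Y)
        (AsyncComm.noiseExponent Q star P)) ∧
    (∀ R : ℝ, 0 < R → R ≤ AsyncComm.syncCapacity Q →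
      IsGreatest (AsyncComm.noiseExponent Q star ''
          {P ∈ stdSimplex ℝ X | R ≤ AsyncComm.mutualInfo P Q})
        (AsyncComm.alphaMinus Q star R) ∧
      AsyncComm.alphaMinus Q star R ≤ AsyncComm.asyncCapacity Q star R) := by
  refine ⟨fun α hα P hP h => AsyncComm.achievable_mutualInfo hQ star hC hα hP h,
    fun P hP => AsyncComm.isLeast_noiseExponent hQ star hP, fun R hR hRC => ?_⟩
  exact ⟨AsyncComm.isGreatest_alphaMinus hQ star hRC,
    AsyncComm.alphaMinus_le_asyncCapacity hQ star hC hR⟩
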